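/- **Notation.** Write points of $\mathbb R^3$ as $x=(x_{12},x_3)$ with $x_{12}\in\mathbb R^2$, $x_3\in\mathbb R$, and identify $\xi\in\mathbb R^2$ with $(\xi,0)\in\mathbb R^3$. Let $\mathcal S(\mathbb R^+\times\mathbb R^2)$ be the space of complex Schwartz functions $\varphi(t,\xi)$ on $\mathbb R\times\mathbb R^2$ supported in $\{t\ge 0\}$, $\mathcal S(\mathbb R^2\times\mathbb R^+)$ the space of Schwartz functions $h(x)$ on $\mathbb R^3$ supported in $\{x_3\ge 0\}$, and $\mathcal S_e(\mathbb R^3)$ the space of Schwartz functions on $\mathbb R^3$ that are even in $x_3$, all with the topology of the Schwartz space. On $\mathbb R^3$ the Fourier transform is $(\mathcal Ff)(\eta)=(2\pi)^{-3/2}\int f(x)e^{i\eta\cdot x}\,dx$; for functions of $(t,\xi)\in\mathbb R\times\mathbb R^2$ it is $(\mathcal F\varphi)(\omega,\sigma)=(2\pi)^{-3/2}\int\varphi(t,\xi)e^{i(\omega t+\sigma\cdot\xi)}\,dt\,d\xi$. Pairings are $\langle f,g\rangle=\int f\,\overline g$. **The operator $R$.** For every $h\in\mathcal S(\mathbb R^3)$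 there is exactly one function $p$ on $\mathbb R\times\mathbb R^3$ that vanishes for $t<0$, is continuous on $[0,\infty)\times\mathbb R^3$, and satisfies $\partial_{tt}p-\Delta p=\delta'(t)\,h(x)$ in the sense of distributions on $\mathbb R\times\mathbb R^3$. The integrated photoacoustic operator is $$(Rh)(t,\xi)=\int_{-\infty}^t p(\tau,(\xi,0))\,d\tau ,\qquad t\in\mathbb R,\ \xi\in\mathbb R^2 ,$$ and it is the spherical mean operator: $(Rh)(t,\xi)=\frac{t}{4\pi}\int_{S^2}h(\xi+t\eta)\,dS(\eta)$ for $t\ge0$. **Theorem.** There exists a continuous linear operator $R^*:\mathcal S(\mathbb R^+\times\mathbb R^2)\to\mathcal S_e(\mathbb R^3)$ such that $$\langle Rh,\varphi\rangle=\langle h,R^*\varphi\rangle\qquad\text{for all } h\in\mathcal S(\mathbb R^2\times\mathbb R^+),\ \varphi\in\mathcal S(\mathbb R^+\times\mathbb R^2),$$ the integral on the left converging absolutely. In the time domain $R^*$ is given, for all $x\in\mathbb R^3$, by the absolutely convergent integral $$(R^*\varphi)(x)=\frac1{4\pi}\int_{\mathbb R^2}\varphi(|x-\xi|,\xi)\,|x-\xi|^{-1}\,d\xi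 ,$$ and in the frequency domain, for all $(\sigma,\varrho)\in\mathbb R^2\times\mathbb R$ with $(\sigma,\varrho)\ne(0,0)$, by $$(\mathcal FR^*\varphi)(\sigma,\varrho)=\frac1{2i}\,\frac{\mathcal F\varphi\big(\sqrt{|\sigma|^2+\varrho^2},\sigma\big)-\mathcal F\varphi\big(-\sqrt{|\sigma|^2+\varrho^2},\sigma\big)}{\sqrt{|\sigma|^2+\varrho^2}} .$$ -/

import Mathlib

open scoped SchwartzMap ContDiff Laplacian InnerProductSpace
open MeasureTheory

noncomputable section

namespace Photoacoustic

/-- The plane `ℝ²` with its Euclidean norm. -/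
abbrev E2 := EuclideanSpace ℝ (Fin 2)

/-- The space `ℝ³` with its Euclidean norm. -/
abbrev E3 := EuclideanSpace ℝ (Fin 3)

/-- The point `(y, s)` of `ℝ³` with `x₁₂ = y ∈ ℝ²` and `x₃ = s`. The observation plane consists
of the points `pt ξ 0`. -/
def pt (y : E2) (s : ℝ) : E3 := !₂[y 0, y 1, s]

/-- `𝓢(D)`: the Schwartz functions whose support lies in `D`, with the topology of `𝓢(E, ℂ)`. -/
def schwartzOn {E : Type*} [NormedAddCommGroup E] [NormedSpace ℝ E] (D : Set E) :
    Submodule ℂ 𝓢(E, ℂ) where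
  carrier := {φ | tsupport (φ : E → ℂ) ⊆ D}
  zero_mem' := by
    have h0 : ((0 : 𝓢(E, ℂ)) : E → ℂ) = 0 := rfl
    simp [tsupport, h0]
  add_mem' := by
    intro f g hf hg
    exact (tsupport_add (f : E → ℂ) (g : E → ℂ)).trans (Set.union_subset hf hg)
  smul_mem' := by
    intro c f hf
    refine Set.Subset.trans ?_ hf
    exact closure_mono (Function.support_const_smul_subset c (f : E → ℂ))

/-- `𝓢(ℝ⁺ × ℝ²)`: Schwartz functions `φ(t, ξ)` supported in `{t ≥ 0}`. -/
abbrev SchwartzTime : Submodule ℂ 𝓢(ℝ × E2, ℂ) := schwartzOn {z : ℝ × E2 | 0 ≤ z.1}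

/-- `𝓢(ℝ² × ℝ⁺)`: Schwartz functions `h(x)` on `ℝ³` supported in `{x₃ ≥ 0}`. -/
abbrev SchwartzHalfSpace : Submodule ℂ 𝓢(E3, ℂ) := schwartzOn {x : E3 | 0 ≤ x 2}

/-- `𝓢ₑ(ℝ³)`: Schwartz functions on `ℝ³` that are even in `x₃`. -/
def SchwartzEven : Submodule ℂ 𝓢(E3, ℂ) where
  carrier := {ψ | ∀ (y : E2) (s : ℝ), ψ (pt y (-s)) = ψ (pt y s)}
  zero_mem' := by intro y s; rfl
  add_mem' := by
    intro f g hf hg y s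
    simp [hf y s, hg y s]
  smul_mem' := by
    intro c f hf y s
    simp [hf y s]

/-- The Fourier transform `(2π)^{-3/2} ∫ f(x) e^{i η · x} dx` on `ℝ³`. -/
def fourierSpace (f : E3 → ℂ) (η : E3) : ℂ :=
  (((2 * Real.pi) ^ (3 / 2 : ℝ) : ℝ) : ℂ)⁻¹ *
    ∫ x : E3, f x * Complex.exp (Complex.I * ((⟪η, x⟫_ℝ : ℝ) : ℂ))

/-- The Fourier transform `(2π)^{-3/2} ∫ f(t, ξ) e^{i (w t + σ · ξ)} dt dξ` on `ℝ × ℝ²`. -/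
def fourierTime (f : ℝ × E2 → ℂ) (w : ℝ) (σ : E2) : ℂ :=
  (((2 * Real.pi) ^ (3 / 2 : ℝ) : ℝ) : ℂ)⁻¹ *
    ∫ z : ℝ × E2, f z * Complex.exp (Complex.I * ((w * z.1 + ⟪σ, z.2⟫_ℝ : ℝ) : ℂ))

/-- `p` is the causal solution of the wave equation `∂ₜₜ p - Δ p = δ'(t) h(x)` on `ℝ × ℝ³`:
`p` vanishes for `t < 0`, is continuous on `{t ≥ 0}` (so that its restriction to the observation
plane makes sense), and solves the equation in the sense of distributions. -/
structure IsPressure (h : E3 → ℂ) (p : ℝ → E3 → ℂ) : Prop where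
  causal : ∀ t < 0, ∀ x, p t x = 0
  continuousOn : ContinuousOn (fun z : ℝ × E3 => p z.1 z.2) {z | 0 ≤ z.1}
  wave : ∀ θ : ℝ × E3 → ℂ, ContDiff ℝ ∞ θ → HasCompactSupport θ →
    ∫ z : ℝ × E3, p z.1 z.2 *
        (iteratedDeriv 2 (fun t => θ (t, z.2)) z.1 - (Δ (fun x => θ (z.1, x))) z.2) =
      -∫ x : E3, h x * deriv (fun t => θ (t, x)) 0

/-- The pressure `p` generated by the source `h`. -/
def pressure (h : E3 → ℂ) : ℝ → E3 → ℂ := Classical.epsilon (IsPressure h)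

/-- The integrated photoacoustic operator
`(R h)(t, ξ) = ∫_{-∞}^t p(τ, ξ) dτ`, with `ξ` in the observation plane `ℝ² × {0}`. -/
def R (h : E3 → ℂ) (t : ℝ) (ξ : E2) : ℂ :=
  ∫ τ in Set.Iic t, pressure h τ (pt ξ 0)

end Photoacoustic

end

open Photoacoustic

open scoped SchwartzMap ContDiff Laplacian InnerProductSpace
open MeasureTheory
noncomputable section
namespace Photoacoustic
open Set Filter Topology Metric

/-! The engine is the Euler–Poisson–Darboux identity for integrals over spheres
(`integral_sphere_darboux`). Rotation invariance makes every infinitesimal rotation integrate to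
zero over the sphere. Summing the squares of the three infinitesimal rotations removes the
tangential part of the Laplacian and leaves radial derivatives.

The identity is used three times. Applied to a plane wave it gives a harmonic oscillator in the
radius, so the sphere integral of `exp (i k·rη)` is `4π sin(r|k|)/(r|k|)` (`integral_sphere_exp`).
Along light cones it turns the retarded-type integral of `□ g` into a radial total derivative, so
`adv` is a left inverse of `□` on test functions (`adv_box`). As `adv` commutes with derivatives, it
is also a right inverse there (`box_adv`).

Existence of the pressure: Kirchhoff's formula is the time derivative of the spherical mean. Paired
with `□ θ`, one integration by parts and Fubini produce the advanced potential of `□ ∂ₜθ`, hence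
`∂ₜθ` at time zero. Uniqueness is by duality: any test function agrees on `t ≥ 0` with `□ θ` for
some test function `θ`, so the equation determines all pairings of a causal solution. Integrating
Kirchhoff's formula in time gives the spherical mean formula for `R`.

The adjoint identity is polar coordinates around each detector `(ξ, 0)` followed by Fubini; the
frequency formula is the same computation with a plane wave in place of `h`. That `R*` maps into
Schwartz functions rests on infinite-order vanishing of `φ` at `t = 0`
(`SchwartzTime.exists_bound`), which absorbs every negative power of `|x - ξ|` created by
differentiation. -/

/-! ### Surface integrals over the unit sphere: polar coordinates, parameters, invariance. -/

/-- The unit sphere of `ℝ³`. -/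
abbrev S2 := sphere (0 : E3) 1

/-- The surface measure of the unit sphere of `ℝ³`. -/
abbrev surf : Measure S2 := (volume : Measure E3).toSphere

theorem finrank_E3 : Module.finrank ℝ E3 = 3 := by simp

theorem norm_coe_S2 (η : S2) : ‖(η : E3)‖ = 1 := by simp

theorem integral_polar {f : E3 → ℂ} (hf : Integrable f) :
    ∫ x, f x = ∫ r in Ioi (0 : ℝ), ((r ^ 2 : ℝ) : ℂ) * ∫ η : S2, f (r • (η : E3)) ∂surf := by
  have hmp := (volume : Measure E3).measurePreserving_homeomorphUnitSphereProd
  rw [finrank_E3] at hmp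
  have hemb := (homeomorphUnitSphereProd E3).measurableEmbedding
  have hfc : ∀ x : ({0}ᶜ : Set E3), f x =
      (fun p : S2 × Ioi (0 : ℝ) => f (p.2.1 • (p.1 : E3))) (homeomorphUnitSphereProd E3 x) := by
    intro x
    have hx : ‖(x : E3)‖ ≠ 0 := norm_ne_zero_iff.2 x.2
    simp [smul_smul, hx]
  have hint : Integrable (fun p : S2 × Ioi (0 : ℝ) => f (p.2.1 • (p.1 : E3)))
      (surf.prod (Measure.volumeIoiPow 2)) := by
    rw [← hmp.integrable_comp_emb hemb]
    have : Integrable (fun x : ({0}ᶜ : Set E3) => f x)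
        (Measure.comap (Subtype.val : ({0}ᶜ : Set E3) → E3) volume) :=
      (integrableOn_iff_comap_subtypeVal (measurableSet_singleton (0 : E3)).compl).1
        hf.integrableOn
    exact this.congr (Eventually.of_forall hfc)
  calc ∫ x, f x = ∫ x : ({0}ᶜ : Set E3), f x ∂(Measure.comap Subtype.val (volume : Measure E3)) := by
        rw [integral_subtype_comap (measurableSet_singleton _).compl f, restrict_compl_singleton]
    _ = ∫ p, f (p.2.1 • (p.1 : E3)) ∂(surf.prod (Measure.volumeIoiPow 2)) := by
        rw [← hmp.integral_comp hemb]
        exact integral_congr_ae (Eventually.of_forall hfc)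
    _ = ∫ r : Ioi (0 : ℝ), ∫ η : S2, f (r.1 • (η : E3)) ∂surf ∂(Measure.volumeIoiPow 2) :=
        integral_prod_symm _ hint
    _ = _ := by
      simp only [Measure.volumeIoiPow, ENNReal.ofReal]
      rw [integral_withDensity_eq_integral_smul,
        integral_subtype_comap measurableSet_Ioi
          fun a : ℝ ↦ Real.toNNReal (a ^ 2) • ∫ η : S2, f (a • (η : E3)) ∂surf]
      · refine setIntegral_congr_fun measurableSet_Ioi fun x hx ↦ ?_
        rw [NNReal.smul_def, Real.coe_toNNReal _ (sq_nonneg x), Complex.real_smul]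
      · exact (measurable_subtype_coe.pow_const _).real_toNNReal

theorem continuous_sphere_integral {X : Type*} [TopologicalSpace X] [FirstCountableTopology X]
    [LocallyCompactSpace X] {F : X → E3 → ℂ} (hF : Continuous (Function.uncurry F)) :
    Continuous fun x => ∫ η : S2, F x η ∂surf := by
  have h : Continuous (Function.uncurry fun (x : X) (η : S2) => F x η) :=
    hF.comp (continuous_fst.prodMk (continuous_subtype_val.comp continuous_snd))
  simpa using continuous_parametric_integral_of_continuous (μ := surf) h isCompact_univ

theorem integrable_sphere {f : E3 → ℂ} (hf : Continuous f) :
    Integrable (fun η : S2 => f η) surf := by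
  rw [← integrableOn_univ]
  exact (hf.comp continuous_subtype_val).continuousOn.integrableOn_compact isCompact_univ

theorem hasDerivAt_sphere_integral {F F' : ℝ → E3 → ℂ} (hF : ∀ t, Continuous (F t))
    (hF' : Continuous (Function.uncurry F')) (h : ∀ t y, HasDerivAt (fun s => F s y) (F' t y) t)
    (t : ℝ) : HasDerivAt (fun s => ∫ η : S2, F s η ∂surf) (∫ η : S2, F' t η ∂surf) t := by
  obtain ⟨C, hC⟩ := ((isCompact_closedBall t 1).prod (isCompact_sphere (0 : E3) 1)).exists_bound_of_continuousOn
    hF'.continuousOn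
  refine (hasDerivAt_integral_of_dominated_loc_of_deriv_le (bound := fun _ => C)
    (F := fun s (η : S2) => F s η) (F' := fun s (η : S2) => F' s η)
    (ball_mem_nhds t one_pos) ?_ (integrable_sphere (hF t)) ?_ ?_ (integrable_const C) ?_).2
  · exact Eventually.of_forall fun s => (integrable_sphere (hF s)).aestronglyMeasurable
  · exact (integrable_sphere (hF'.comp (Continuous.prodMk_right t))).aestronglyMeasurable
  · exact Eventually.of_forall fun η s hs => hC (s, η) ⟨ball_subset_closedBall hs, η.2⟩
  · exact Eventually.of_forall fun η s _ => h s η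

/-- Extending `f` from the sphere homogeneously of degree zero expresses the surface integral
through Lebesgue measure, whose isometry invariance is then inherited by `surf`. The factor is `∫₀¹
r² dr = 1/3`. -/
theorem integral_sphere_eq_integral_ball {f : E3 → ℂ} (hf : Continuous f) :
    ∫ x, (ball (0 : E3) 1).indicator (fun x => f (‖x‖⁻¹ • x)) x = (1 / 3) * ∫ η : S2, f η ∂surf := by
  obtain ⟨C, hC⟩ := (isCompact_closedBall (0 : E3) 1).exists_bound_of_continuousOn hf.continuousOn
  have hint : Integrable ((ball (0 : E3) 1).indicator (fun x => f (‖x‖⁻¹ • x))) := by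
    rw [integrable_indicator_iff measurableSet_ball]
    refine Measure.integrableOn_of_bounded (M := C) measure_ball_lt_top.ne ?_ ?_
    · exact (hf.measurable.comp (by fun_prop)).aestronglyMeasurable
    · refine Eventually.of_forall fun x => hC _ ?_
      rw [mem_closedBall_zero_iff, norm_smul, norm_inv, norm_norm]
      exact inv_mul_le_one
  rw [integral_polar hint]
  have h1 : ∀ r ∈ Ioi (0 : ℝ), ((r ^ 2 : ℝ) : ℂ) * ∫ η : S2, (ball (0 : E3) 1).indicator
      (fun x => f (‖x‖⁻¹ • x)) (r • (η : E3)) ∂surf =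
      (Iio (1 : ℝ)).indicator (fun r => ((r ^ 2 : ℝ) : ℂ) * ∫ η : S2, f η ∂surf) r := by
    intro r hr
    have hr' : (0 : ℝ) < r := hr
    by_cases h : r < 1
    · have : ∀ η : S2, r • (η : E3) ∈ ball (0 : E3) 1 := fun η => by
        simp [norm_smul, abs_of_pos hr', h]
      simp [indicator_of_mem, this, h, norm_smul, abs_of_pos hr', smul_smul, hr'.ne']
    · have : ∀ η : S2, r • (η : E3) ∉ ball (0 : E3) 1 := fun η => by
        simpa [norm_smul, abs_of_pos hr'] using h
      simp [indicator_of_notMem, this, h]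
  rw [setIntegral_congr_fun measurableSet_Ioi h1, setIntegral_indicator measurableSet_Iio,
    Ioi_inter_Iio, integral_mul_const, integral_complex_ofReal, ← integral_Ioc_eq_integral_Ioo,
    ← intervalIntegral.integral_of_le zero_le_one]
  norm_num

theorem integral_sphere_comp_isometry {f : E3 → ℂ} (hf : Continuous f) (L : E3 ≃ₗᵢ[ℝ] E3) :
    ∫ η : S2, f (L η) ∂surf = ∫ η : S2, f η ∂surf := by
  have h1 := integral_sphere_eq_integral_ball hf
  have h2 := integral_sphere_eq_integral_ball (hf.comp L.continuous)
  rw [← L.measurePreserving.integral_comp L.toHomeomorph.measurableEmbedding] at h1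
  have h3 : ∀ x, (ball (0 : E3) 1).indicator (fun x => f (‖x‖⁻¹ • x)) (L x) =
      (ball (0 : E3) 1).indicator (fun x => (f ∘ L) (‖x‖⁻¹ • x)) x := by
    intro x
    by_cases hx : x ∈ ball (0 : E3) 1
    · have : L x ∈ ball (0 : E3) 1 := by simpa using hx
      rw [indicator_of_mem hx, indicator_of_mem this]
      simp
    · have : L x ∉ ball (0 : E3) 1 := by simpa using hx
      rw [indicator_of_notMem hx, indicator_of_notMem this]
  simp_rw [h3, h2] at h1
  simpa using h1

/-! ### Infinitesimal rotations and the Darboux identity. -/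

/-- The standard basis vectors of `ℝ³`. -/
abbrev e3 (i : Fin 3) : E3 := EuclideanSpace.single i 1

/-- The infinitesimal rotation in the plane spanned by the `i`-th and `j`-th axes. -/
def infRot (i j : Fin 3) (y : E3) : E3 := y i • e3 j - y j • e3 i

/-- The rotation by `α` in the plane spanned by the `i`-th and `j`-th axes. -/
def rot (i j : Fin 3) (α : ℝ) (y : E3) : E3 :=
  y + ((Real.cos α - 1) * y i - Real.sin α * y j) • e3 i
    + (Real.sin α * y i + (Real.cos α - 1) * y j) • e3 j

theorem norm_rot {i j : Fin 3} (hij : i ≠ j) (α : ℝ) (y : E3) : ‖rot i j α y‖ = ‖y‖ := by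
  have h := Real.sin_sq_add_cos_sq α
  rw [EuclideanSpace.norm_eq, EuclideanSpace.norm_eq]
  congr 1
  simp only [Real.norm_eq_abs, sq_abs, Fin.sum_univ_three]
  have hs : Real.sin α ^ 2 = 1 - Real.cos α ^ 2 := by linarith
  fin_cases i <;> fin_cases j <;> simp [rot] at hij ⊢ <;> ring_nf <;> rw [hs] <;> ring

/-- Rotation in a coordinate plane as a linear isometry. -/
def rotEquiv {i j : Fin 3} (hij : i ≠ j) (α : ℝ) : E3 ≃ₗᵢ[ℝ] E3 :=
  LinearIsometry.toLinearIsometryEquiv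
    { toFun := rot i j α
      map_add' := fun x y => by simp only [rot, PiLp.add_apply]; module
      map_smul' := fun c y => by
        simp only [rot, PiLp.smul_apply, smul_eq_mul, RingHom.id_apply]; module
      norm_map' := norm_rot hij α } rfl

theorem hasDerivAt_rot (i j : Fin 3) (α : ℝ) (y : E3) :
    HasDerivAt (fun s => rot i j s y)
      ((-Real.sin α * y i - Real.cos α * y j) • e3 i
        + (Real.cos α * y i - Real.sin α * y j) • e3 j) α := by
  have hs := Real.hasDerivAt_sin α
  have hc := Real.hasDerivAt_cos α
  unfold rot
  have h1 := ((((hc.sub_const 1).mul_const (y i)).sub (hs.mul_const (y j))).smul_const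
    (e3 i)).const_add y
  have h2 := (((hs.mul_const (y i)).add ((hc.sub_const 1).mul_const (y j))).smul_const (e3 j))
  refine (h1.add h2).congr_deriv ?_
  module

/-- The integral of `f` over the rotated sphere does not depend on the angle; this is its derivative
at angle zero. It replaces the divergence theorem on the sphere. -/
theorem integral_sphere_infRot {f : E3 → ℂ} (hf : ContDiff ℝ 1 f) {i j : Fin 3} (hij : i ≠ j) :
    ∫ η : S2, fderiv ℝ f η (infRot i j η) ∂surf = 0 := by
  have hrot : Continuous fun q : ℝ × E3 => rot i j q.1 q.2 := by unfold rot; fun_prop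
  have hD := hf.continuous_fderiv one_ne_zero
  have key := hasDerivAt_sphere_integral (F := fun s y => f (rot i j s y))
    (F' := fun s y => fderiv ℝ f (rot i j s y) ((-Real.sin s * y i - Real.cos s * y j) • e3 i
        + (Real.cos s * y i - Real.sin s * y j) • e3 j))
    (fun t => hf.continuous.comp (hrot.comp (Continuous.prodMk_right t)))
    (by
      refine (hD.comp hrot).clm_apply ?_
      fun_prop)
    (fun t y => (hf.differentiable one_ne_zero _).hasFDerivAt.comp_hasDerivAt t
      (hasDerivAt_rot i j t y)) 0
  have hconst : (fun s => ∫ η : S2, f (rot i j s η) ∂surf) = fun _ => ∫ η : S2, f η ∂surf :=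
    funext fun s => integral_sphere_comp_isometry hf.continuous (rotEquiv hij s)
  rw [hconst] at key
  have h0 := key.unique (hasDerivAt_const 0 _)
  rw [← h0]
  refine integral_congr_ae (Eventually.of_forall fun η => ?_)
  have : rot i j 0 (η : E3) = η := by simp [rot]
  simp [this, infRot, sub_eq_neg_add]

/-- `infRot` as a continuous linear map. -/
def infRotL (i j : Fin 3) : E3 →L[ℝ] E3 :=
  (EuclideanSpace.proj i : E3 →L[ℝ] ℝ).smulRight (e3 j)
    - (EuclideanSpace.proj j : E3 →L[ℝ] ℝ).smulRight (e3 i)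

theorem infRotL_apply (i j : Fin 3) (y : E3) : infRotL i j y = infRot i j y := by
  simp [infRotL, infRot]

theorem fderiv_comp_affine {E G : Type*} [NormedAddCommGroup E] [NormedSpace ℝ E]
    [NormedAddCommGroup G] [NormedSpace ℝ G] {g : E → ℂ} (hg : ContDiff ℝ 2 g)
    (c : E) (L : G →L[ℝ] E) (y : G) :
    fderiv ℝ (fun y => g (c + L y)) y = (fderiv ℝ g (c + L y)).comp L := by
  have h : HasFDerivAt (fun y => c + L y) L y := L.hasFDerivAt.const_add c
  exact ((hg.differentiable two_ne_zero _).hasFDerivAt.comp y h).fderiv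

theorem fderiv_fderiv_comp_affine {E G : Type*} [NormedAddCommGroup E] [NormedSpace ℝ E]
    [NormedAddCommGroup G] [NormedSpace ℝ G] {g : E → ℂ} (hg : ContDiff ℝ 2 g)
    (c : E) (L : G →L[ℝ] E) (y v w : G) :
    fderiv ℝ (fderiv ℝ (fun y => g (c + L y))) y v w =
      fderiv ℝ (fderiv ℝ g) (c + L y) (L v) (L w) := by
  have h : HasFDerivAt (fun y => c + L y) L y := L.hasFDerivAt.const_add c
  have h1 : fderiv ℝ (fun y => g (c + L y)) = fun y => (fderiv ℝ g (c + L y)).comp L :=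
    funext fun y => fderiv_comp_affine hg c L y
  have hd : Differentiable ℝ (fderiv ℝ g) :=
    (hg.fderiv_right (m := 1) (by norm_num)).differentiable one_ne_zero
  have h2 : HasFDerivAt (fun y => (fderiv ℝ g (c + L y)).comp L) _ y :=
    ((hd _).hasFDerivAt.comp y h).clm_comp (hasFDerivAt_const L y)
  rw [h1, h2.fderiv]
  simp

theorem laplacian_eq_sum {f : E3 → ℂ} (x : E3) :
    (Δ f) x = ∑ i, fderiv ℝ (fderiv ℝ f) x (e3 i) (e3 i) := by
  rw [InnerProductSpace.laplacian_eq_iteratedFDeriv_orthonormalBasis f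
    (EuclideanSpace.basisFun (Fin 3) ℝ)]
  simp [iteratedFDeriv_two_apply]

theorem isSymm_fderiv_fderiv {E : Type*} [NormedAddCommGroup E] [NormedSpace ℝ E] {g : E → ℂ}
    (hg : ContDiff ℝ 2 g) (x v w : E) :
    fderiv ℝ (fderiv ℝ g) x v w = fderiv ℝ (fderiv ℝ g) x w v :=
  (hg.contDiffAt.isSymmSndFDerivAt (by simp)) v w

/-- The three rotation fields satisfy `∑ X ⊗ X = |y|² I - y ⊗ y`. For a Hessian on the unit sphere
this is the full trace minus the radial second derivative. -/
theorem sum_infRot_sq (B : E3 →L[ℝ] E3 →L[ℝ] ℂ) (hB : ∀ v w, B v w = B w v) (y : E3) :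
    B (infRot 0 1 y) (infRot 0 1 y) + B (infRot 0 2 y) (infRot 0 2 y)
      + B (infRot 1 2 y) (infRot 1 2 y) =
      ((‖y‖ ^ 2 : ℝ) : ℂ) * ∑ i, B (e3 i) (e3 i) - B y y := by
  have hy : y = y 0 • e3 0 + y 1 • e3 1 + y 2 • e3 2 := by
    ext i; fin_cases i <;> simp
  have h2 : B y y = B (y 0 • e3 0 + y 1 • e3 1 + y 2 • e3 2)
    (y 0 • e3 0 + y 1 • e3 1 + y 2 • e3 2) := by rw [← hy]
  rw [h2, EuclideanSpace.norm_sq_eq]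
  simp only [infRot, Fin.sum_univ_three, map_add, map_sub, map_smul, add_apply,
    sub_apply, smul_apply, Complex.real_smul,
    Real.norm_eq_abs, sq_abs]
  rw [hB (e3 1) (e3 0), hB (e3 2) (e3 0), hB (e3 2) (e3 1)]
  push_cast
  ring

/-- The first-order part of the sum of squared rotation fields; it is the source of the coefficient
`2 = 3 - 1` in the Darboux identity. -/
theorem sum_infRot_infRot (y : E3) :
    infRot 0 1 (infRot 0 1 y) + infRot 0 2 (infRot 0 2 y) + infRot 1 2 (infRot 1 2 y) =
      (-2 : ℝ) • y := by
  ext i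
  fin_cases i <;> simp [infRot] <;> ring

/-- `integral_sphere_infRot` applied to `y ↦ Df(x + r y)(X y)`, with `X` the rotation field: the
product rule yields the second-order term and the term with `X (X y)`. -/
theorem integral_sphere_infRot_sq {f : E3 → ℂ} (hf : ContDiff ℝ 2 f) (x : E3) (r : ℝ)
    {i j : Fin 3} (hij : i ≠ j) :
    ∫ η : S2, (r * fderiv ℝ (fderiv ℝ f) (x + r • (η : E3)) (infRot i j η) (infRot i j η)
      + fderiv ℝ f (x + r • (η : E3)) (infRot i j (infRot i j η))) ∂surf = 0 := by
  have hf1 : ContDiff ℝ 1 (fderiv ℝ f) := hf.fderiv_right (by norm_num)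
  have hu : ContDiff ℝ 1 fun y : E3 => fderiv ℝ f (x + r • y) (infRotL i j y) := by fun_prop
  rw [← integral_sphere_infRot hu hij]
  refine integral_congr_ae (Eventually.of_forall fun η => ?_)
  have h : HasFDerivAt (fun y : E3 => x + r • y) (r • ContinuousLinearMap.id ℝ E3) (η : E3) :=
    ((hasFDerivAt_id (η : E3)).const_smul r).const_add x
  have h2 := (((hf1.differentiable one_ne_zero _).hasFDerivAt.comp (η : E3) h).clm_apply
    (infRotL i j).hasFDerivAt).fderiv
  simp only [Function.comp_def] at h2
  simp only [← infRotL_apply]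
  rw [h2]
  simp only [add_apply, ContinuousLinearMap.comp_apply,
    ContinuousLinearMap.flip_apply, smul_apply, ContinuousLinearMap.id_apply,
    map_smul, Complex.real_smul]
  ring

/-- The Euler-Poisson-Darboux identity for spherical means. -/
theorem integral_sphere_darboux {f : E3 → ℂ} (hf : ContDiff ℝ 2 f) (x : E3) (r : ℝ) :
    ∫ η : S2, (2 * fderiv ℝ f (x + r • (η : E3)) η
      + r * fderiv ℝ (fderiv ℝ f) (x + r • (η : E3)) η η) ∂surf =
    ∫ η : S2, (r : ℂ) * (Δ f) (x + r • (η : E3)) ∂surf := by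
  have hf1 : ContDiff ℝ 1 (fderiv ℝ f) := hf.fderiv_right (by norm_num)
  have hf2 : Continuous (fderiv ℝ (fderiv ℝ f)) := hf1.continuous_fderiv one_ne_zero
  have hf1c : Continuous (fderiv ℝ f) := hf1.continuous
  have hI : ∀ i j : Fin 3, Continuous (infRot i j) := fun i j => by unfold infRot; fun_prop
  have hint : ∀ i j : Fin 3, Integrable (fun η : S2 =>
      (r * fderiv ℝ (fderiv ℝ f) (x + r • (η : E3)) (infRot i j η) (infRot i j η)
      + fderiv ℝ f (x + r • (η : E3)) (infRot i j (infRot i j η)))) surf := fun i j => by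
    refine integrable_sphere (f := fun η =>
      (r * fderiv ℝ (fderiv ℝ f) (x + r • (η : E3)) (infRot i j η) (infRot i j η)
      + fderiv ℝ f (x + r • (η : E3)) (infRot i j (infRot i j η)))) ?_
    have := hI i j
    fun_prop
  have h01 := integral_sphere_infRot_sq hf x r (show (0 : Fin 3) ≠ 1 by decide)
  have h02 := integral_sphere_infRot_sq hf x r (show (0 : Fin 3) ≠ 2 by decide)
  have h12 := integral_sphere_infRot_sq hf x r (show (1 : Fin 3) ≠ 2 by decide)
  have hsum : ∫ η : S2, (r * (Δ f) (x + r • (η : E3)) - (2 * fderiv ℝ f (x + r • (η : E3)) η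
      + r * fderiv ℝ (fderiv ℝ f) (x + r • (η : E3)) η η)) ∂surf = 0 := by
    have := integral_add ((hint 0 1).add (hint 0 2)) (hint 1 2)
    have h' := integral_add (hint 0 1) (hint 0 2)
    simp only [Pi.add_apply] at this
    rw [h', h01, h02, h12, add_zero, add_zero] at this
    rw [← this]
    refine integral_congr_ae (Eventually.of_forall fun η => ?_)
    have e1 := sum_infRot_sq (fderiv ℝ (fderiv ℝ f) (x + r • (η : E3)))
      (isSymm_fderiv_fderiv hf _) η
    have e2 := congrArg (fderiv ℝ f (x + r • (η : E3))) (sum_infRot_infRot η)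
    rw [map_add, map_add, map_smul, Complex.real_smul] at e2
    rw [← laplacian_eq_sum, norm_coe_S2] at e1
    push_cast at e1 e2
    dsimp only
    -- With `|η| = 1` the three rotation terms add up to `r (Δf - D²f(η, η)) - 2 Df(η)`.
    linear_combination -(r : ℂ) * e1 - e2
  have hΔ : Continuous (Δ f) := by
    rw [funext laplacian_eq_sum]; fun_prop
  rw [integral_sub] at hsum
  · exact (sub_eq_zero.1 hsum).symm
  · exact integrable_sphere (f := fun η => r * (Δ f) (x + r • (η : E3))) (by fun_prop)
  · exact integrable_sphere (f := fun η => 2 * fderiv ℝ f (x + r • (η : E3)) η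
      + r * fderiv ℝ (fderiv ℝ f) (x + r • (η : E3)) η η) (by fun_prop)

/-! ### The sphere integral of a plane wave. -/

/-- Rotating the phase vector `(N, N')` back by the angle `r` gives two conserved quantities, from
which `N` is recovered. -/
theorem eq_sin_of_deriv_deriv_eq_neg {N N' : ℝ → ℂ} (h : ∀ r, HasDerivAt N (N' r) r)
    (h' : ∀ r, HasDerivAt N' (-N r) r) (h0 : N 0 = 0) (r : ℝ) : N r = N' 0 * Real.sin r := by
  have hs : ∀ r : ℝ, HasDerivAt (fun r : ℝ => (Real.sin r : ℂ)) (Real.cos r) r := fun r =>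
    (Real.hasDerivAt_sin r).ofReal_comp
  have hc : ∀ r : ℝ, HasDerivAt (fun r : ℝ => (Real.cos r : ℂ)) ((-Real.sin r : ℝ) : ℂ) r :=
    fun r => (Real.hasDerivAt_cos r).ofReal_comp
  have hA : ∀ r, HasDerivAt (fun r => N r * Real.sin r + N' r * Real.cos r) 0 r := fun r => by
    refine (((h r).mul (hs r)).add ((h' r).mul (hc r))).congr_deriv ?_
    push_cast; ring
  have hB : ∀ r, HasDerivAt (fun r => N r * Real.cos r - N' r * Real.sin r) 0 r := fun r => by
    refine (((h r).mul (hc r)).sub ((h' r).mul (hs r))).congr_deriv ?_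
    push_cast; ring
  have eA := is_const_of_deriv_eq_zero (fun r => (hA r).differentiableAt)
    (fun r => (hA r).deriv) r 0
  have eB := is_const_of_deriv_eq_zero (fun r => (hB r).differentiableAt)
    (fun r => (hB r).deriv) r 0
  simp [h0] at eA eB
  have hsc : (Complex.sin r) ^ 2 + Complex.cos r ^ 2 = 1 := Complex.sin_sq_add_cos_sq _
  push_cast
  linear_combination Complex.sin r * eA + Complex.cos r * eB - N r * hsc

theorem surf_univ : surf.real univ = 4 * Real.pi := by
  rw [Measure.toSphere_real_apply_univ, finrank_E3, Measure.real, EuclideanSpace.volume_ball_fin_three]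
  rw [ENNReal.toReal_mul, ENNReal.toReal_ofReal (by positivity)]
  simp; ring

/-- The Fourier transform of the surface measure of the sphere. -/
theorem integral_sphere_exp {k : E3} (hk : ‖k‖ = 1) (r : ℝ) :
    r * ∫ η : S2, Complex.exp (Complex.I * ((r * ⟪k, (η : E3)⟫_ℝ : ℝ) : ℂ)) ∂surf =
      4 * Real.pi * Real.sin r := by
  let a : E3 →L[ℝ] ℂ := (Complex.I • Complex.ofRealCLM).comp (innerSL ℝ k)
  have ha : ∀ y, a y = Complex.I * ((⟪k, y⟫_ℝ : ℝ) : ℂ) := fun y => by simp [a]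
  let f : E3 → ℂ := fun y => Complex.exp (a y)
  have hf : ContDiff ℝ 2 f := by fun_prop
  have hf1 : ∀ y, HasFDerivAt f (f y • a) y := fun y => a.hasFDerivAt.cexp
  have hf1' : fderiv ℝ f = fun y => f y • a := funext fun y => (hf1 y).fderiv
  have hf2 : ∀ y v w, fderiv ℝ (fderiv ℝ f) y v w = f y * a v * a w := fun y v w => by
    rw [hf1', ((hf1 y).smul_const a).fderiv]; simp
  have hΔ : ∀ y, (Δ f) y = -f y := fun y => by
    rw [laplacian_eq_sum]
    have : ∑ i, (((⟪k, e3 i⟫_ℝ : ℝ) : ℂ)) ^ 2 = 1 := by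
      have := EuclideanSpace.norm_sq_eq k
      rw [hk] at this
      simp only [PiLp.inner_apply, Fin.sum_univ_three, Real.norm_eq_abs, sq_abs] at *
      simp
      exact_mod_cast this.symm.trans (one_pow 2)
    simp only [hf2, ha]
    calc _ = - f y * ∑ i, (((⟪k, e3 i⟫_ℝ : ℝ) : ℂ)) ^ 2 := by
          rw [Finset.mul_sum]
          refine Finset.sum_congr rfl fun i _ => ?_
          linear_combination f y * ((⟪k, e3 i⟫_ℝ : ℝ) : ℂ) ^ 2 * Complex.I_sq
      _ = _ := by rw [this, mul_one]
  let F : ℝ → ℂ := fun r => ∫ η : S2, f (r • (η : E3)) ∂surf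
  let F1 : ℝ → ℂ := fun r => ∫ η : S2, fderiv ℝ f (r • (η : E3)) η ∂surf
  let F2 : ℝ → ℂ := fun r => ∫ η : S2, fderiv ℝ (fderiv ℝ f) (r • (η : E3)) η η ∂surf
  have hfc : Continuous f := hf.continuous
  have hF : ∀ r, HasDerivAt F (F1 r) r := hasDerivAt_sphere_integral
    (F := fun r y => f (r • y)) (F' := fun r y => fderiv ℝ f (r • y) y) (fun t => by fun_prop)
    (by simp only [hf1', smul_apply]; unfold Function.uncurry; fun_prop)
    (fun t y => by
      have := hf1 (t • y)
      rw [← (hf1 _).fderiv] at this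
      exact this.comp_hasDerivAt t (by simpa using (hasDerivAt_id t).smul_const y))
  have hF' : ∀ r, HasDerivAt F1 (F2 r) r := hasDerivAt_sphere_integral
    (F := fun r y => fderiv ℝ f (r • y) y) (F' := fun r y => fderiv ℝ (fderiv ℝ f) (r • y) y y)
    (fun t => by simp only [hf1', smul_apply]; fun_prop)
    (by simp only [hf2]; unfold Function.uncurry; fun_prop)
    (fun t y => by
      simp only [hf2]; simp only [hf1', smul_apply, smul_eq_mul]
      refine HasDerivAt.mul_const ?_ (a y)
      exact (hf1 (t • y)).comp_hasDerivAt t (by simpa using (hasDerivAt_id t).smul_const y))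
  -- Since `Δf = -f` for unit `k`, the Darboux identity says `(r F)'' = -(r F)`. The initial slope
  -- of `r F` is `F 0`, the area `4π`.
  have hD : ∀ r : ℝ, 2 * F1 r + r * F2 r = - (r * F r) := fun r => by
    have := integral_sphere_darboux hf 0 r
    simp only [zero_add, hΔ, mul_neg, integral_neg] at this
    rw [integral_const_mul, integral_add, integral_const_mul, integral_const_mul] at this
    · exact this
    · refine (integrable_sphere (f := fun y => fderiv ℝ f (r • y) y) ?_).const_mul 2
      simp only [hf1', smul_apply]; fun_prop
    · refine (integrable_sphere (f := fun y => fderiv ℝ (fderiv ℝ f) (r • y) y y) ?_).const_mul _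
      simp only [hf2]; fun_prop
  have hr : ∀ r : ℝ, HasDerivAt (fun r : ℝ => (r : ℂ)) 1 r := fun r => (hasDerivAt_id r).ofReal_comp
  have := eq_sin_of_deriv_deriv_eq_neg (N := fun r => r * F r) (N' := fun r => F r + r * F1 r)
    (fun r => ((hr r).mul (hF r)).congr_deriv (by ring))
    (fun r => ((hF r).add ((hr r).mul (hF' r))).congr_deriv (by rw [← hD r]; ring)) (by simp) r
  have hF0 : F 0 = 4 * Real.pi := by
    have h1 : F 0 = ((surf.real univ : ℝ) : ℂ) := by simp [F, f]
    rw [h1, surf_univ]; push_cast; ring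
  simp only [hF0, Complex.ofReal_zero, zero_mul, add_zero] at this
  rw [← this]
  simp [F, f, ha, inner_smul_right]

/-! ### Directional derivatives and the wave operator on space-time. -/

/-- Space-time `ℝ × ℝ³`. -/
abbrev ST := ℝ × E3

/-- The directional derivative of `g` in the direction `v`. -/
def dd {E : Type*} [NormedAddCommGroup E] [NormedSpace ℝ E] (v : E) (g : E → ℂ) (z : E) : ℂ :=
  fderiv ℝ g z v

/-- The wave operator on space-time. -/
def box (g : ST → ℂ) (z : ST) : ℂ :=
  dd (1, 0) (dd (1, 0) g) z - ∑ i, dd (0, e3 i) (dd (0, e3 i) g) z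

section dd

variable {E : Type*} [NormedAddCommGroup E] [NormedSpace ℝ E] {g : E → ℂ}

theorem contDiff_dd (hg : ContDiff ℝ ∞ g) (v : E) : ContDiff ℝ ∞ (dd v g) :=
  (hg.fderiv_right (by simp)).clm_apply contDiff_const

theorem hasCompactSupport_dd (hg : HasCompactSupport g) (v : E) : HasCompactSupport (dd v g) :=
  hg.fderiv_apply (𝕜 := ℝ) v

theorem dd_dd (hg : ContDiff ℝ 2 g) (v w z : E) :
    dd v (dd w g) z = fderiv ℝ (fderiv ℝ g) z v w := by
  have hd : Differentiable ℝ (fderiv ℝ g) :=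
    (hg.fderiv_right (m := 1) (by norm_num)).differentiable one_ne_zero
  have := ((hd z).hasFDerivAt.clm_apply (hasFDerivAt_const w z)).fderiv
  unfold dd
  rw [this]
  simp

theorem dd_comm (hg : ContDiff ℝ 2 g) (v w : E) : dd v (dd w g) = dd w (dd v g) := by
  funext z
  rw [dd_dd hg, dd_dd hg, isSymm_fderiv_fderiv hg]

theorem hasDerivAt_comp_dd (hg : ContDiff ℝ ∞ g) {γ : ℝ → E} {v : E} {t : ℝ}
    (hγ : HasDerivAt γ v t) : HasDerivAt (fun s => g (γ s)) (dd v g (γ t)) t :=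
  ((hg.differentiable (by simp) _).hasFDerivAt).comp_hasDerivAt t hγ

end dd

section box

variable {g : ST → ℂ}

theorem contDiff_box (hg : ContDiff ℝ ∞ g) : ContDiff ℝ ∞ (box g) :=
  (contDiff_dd (contDiff_dd hg _) _).sub
    (ContDiff.sum fun _ _ => contDiff_dd (contDiff_dd hg _) _)

theorem tsupport_dd_subset (v : ST) : tsupport (dd v g) ⊆ tsupport g :=
  tsupport_fderiv_apply_subset ℝ v

theorem tsupport_box_subset : tsupport (box g) ⊆ tsupport g := by
  refine closure_minimal (fun z hz => ?_) (isClosed_tsupport g)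
  by_contra h
  have hdd : ∀ v, dd v (dd v g) z = 0 := fun v =>
    image_eq_zero_of_notMem_tsupport fun h' => h (tsupport_dd_subset v (tsupport_dd_subset v h'))
  exact hz (by simp [box, hdd])

theorem hasCompactSupport_box (hg : HasCompactSupport g) : HasCompactSupport (box g) :=
  IsCompact.of_isClosed_subset hg (isClosed_tsupport _) tsupport_box_subset

theorem box_dd_comm (hg : ContDiff ℝ ∞ g) (v : ST) : box (dd v g) = dd v (box g) := by
  have h2 : ∀ {f : ST → ℂ}, ContDiff ℝ ∞ f → ContDiff ℝ 2 f := fun h => contDiff_infty.1 h 2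
  have hc : ∀ w, dd w (dd w (dd v g)) = dd v (dd w (dd w g)) := fun w => by
    rw [dd_comm (h2 hg) w v, dd_comm (h2 (contDiff_dd hg w)) w v]
  have hd : ∀ w, Differentiable ℝ (dd w (dd w g)) := fun w =>
    (contDiff_dd (contDiff_dd hg _) _).differentiable (by simp)
  funext z
  have : dd v (box g) z = dd v (dd (1, 0) (dd (1, 0) g)) z
      - ∑ i, dd v (dd (0, e3 i) (dd (0, e3 i) g)) z := by
    have h := ((hd (1, 0) z).hasFDerivAt.fun_sub
      (HasFDerivAt.fun_sum fun i (_ : i ∈ Finset.univ) => (hd (0, e3 i) z).hasFDerivAt)).fderiv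
    change fderiv ℝ (fun z => _ - _) z v = _
    rw [h]
    simp [dd]
  rw [this]
  simp only [box, hc]

theorem iteratedDeriv_two_slice (hg : ContDiff ℝ 2 g) (t : ℝ) (x : E3) :
    iteratedDeriv 2 (fun t => g (t, x)) t = fderiv ℝ (fderiv ℝ g) (t, x) (1, 0) (1, 0) := by
  have h := fderiv_fderiv_comp_affine hg ((0 : ℝ), x) (ContinuousLinearMap.inl ℝ ℝ E3) t 1 1
  simp only [ContinuousLinearMap.inl_apply, Prod.mk_add_mk, zero_add, add_zero] at h
  rw [← h, iteratedDeriv_eq_iteratedFDeriv, iteratedFDeriv_two_apply]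

theorem laplacian_slice (hg : ContDiff ℝ 2 g) (t : ℝ) (x : E3) :
    (Δ fun x => g (t, x)) x =
      ∑ i, fderiv ℝ (fderiv ℝ g) (t, x) (0, e3 i) (0, e3 i) := by
  rw [laplacian_eq_sum]
  refine Finset.sum_congr rfl fun i _ => ?_
  have h := fderiv_fderiv_comp_affine hg (t, (0 : E3)) (ContinuousLinearMap.inr ℝ ℝ E3) x
    (e3 i) (e3 i)
  simpa only [ContinuousLinearMap.inr_apply, Prod.mk_add_mk, zero_add, add_zero] using h

theorem box_eq (hg : ContDiff ℝ 2 g) (z : ST) :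
    iteratedDeriv 2 (fun t => g (t, z.2)) z.1 - (Δ (fun x => g (z.1, x))) z.2 = box g z := by
  rw [iteratedDeriv_two_slice hg, laplacian_slice hg]
  simp only [box, dd_dd hg]

end box

/-! ### The advanced potential and its inversion of the wave operator. -/

theorem locallyIntegrable_inv_norm : LocallyIntegrable fun y : E3 => ‖y‖⁻¹ := by
  intro x
  refine ⟨ball 0 (‖x‖ + 1), isOpen_ball.mem_nhds (by simp), ?_⟩
  rw [integrableOn_fun_norm_addHaar (volume : Measure E3) (f := fun r : ℝ => r⁻¹), finrank_E3]
  refine IntegrableOn.congr_fun (f := fun y : ℝ => y) ?_ ?_ measurableSet_Ioo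
  · exact (continuous_id.integrableOn_Icc).mono_set Ioo_subset_Icc_self
  · intro y hy
    have : y ≠ 0 := hy.1.ne'
    simp only [smul_eq_mul]
    field_simp

/-- The Newtonian-type weight `1 / (4 π ‖y‖)`. -/
def newton (y : E3) : ℂ := ((4 * Real.pi * ‖y‖)⁻¹ : ℝ)

theorem locallyIntegrable_newton : LocallyIntegrable newton := by
  have h := (locallyIntegrable_inv_norm.smul ((4 * Real.pi)⁻¹))
  have h2 : newton = fun y => (((4 * Real.pi)⁻¹ • fun y : E3 => ‖y‖⁻¹) y : ℂ) := by
    funext y; simp [newton]; ring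
  rw [h2]
  intro x
  obtain ⟨s, hs, hi⟩ := h x
  exact ⟨s, hs, hi.ofReal⟩

theorem integrable_newton_mul {f : E3 → ℂ} (hf : Continuous f) (hc : HasCompactSupport f) :
    Integrable fun y => newton y * f y :=
  locallyIntegrable_newton.integrable_smul_right_of_hasCompactSupport hf hc

/-- Integration against the Newtonian weight in polar coordinates. -/
theorem integral_newton_mul {f : E3 → ℂ} (hf : Integrable fun y => newton y * f y) :
    ∫ y, newton y * f y =
      (4 * Real.pi : ℂ)⁻¹ * ∫ r in Ioi (0 : ℝ), ∫ η : S2, r * f (r • (η : E3)) ∂surf := by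
  rw [integral_polar hf, ← integral_const_mul]
  refine setIntegral_congr_fun measurableSet_Ioi fun r hr => ?_
  have hr' : (0 : ℝ) < r := hr
  have hrc : (r : ℂ) ≠ 0 := by exact_mod_cast hr'.ne'
  rw [← integral_const_mul, ← integral_const_mul]
  congr 1
  funext η
  simp only [newton, norm_smul, norm_coe_S2, Real.norm_eq_abs, abs_of_pos hr']
  push_cast
  field_simp

/-- The advanced potential of `q`. -/
def adv (q : ST → ℂ) (z : ST) : ℂ := ∫ y, newton y * q (z.1 + ‖y‖, z.2 - y)

theorem hasCompactSupport_cone {q : ST → ℂ} (hc : HasCompactSupport q) (z : ST) :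
    HasCompactSupport fun y : E3 => q (z.1 + ‖y‖, z.2 - y) := by
  have : Topology.IsClosedEmbedding fun y : E3 => ((z.1 + ‖y‖, z.2 - y) : ST) := by
    refine Topology.IsClosedEmbedding.of_continuous_injective_isClosedMap (by fun_prop)
      (fun a b h => by simpa using (Prod.ext_iff.1 h).2) ?_
    have hl : Function.LeftInverse (fun p : ST => z.2 - p.2)
      (fun y : E3 => ((z.1 + ‖y‖, z.2 - y) : ST)) := fun y => by simp
    exact (hl.isClosedEmbedding (by fun_prop) (by fun_prop)).isClosedMap
  exact hc.comp_isClosedEmbedding this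

theorem integrable_adv {q : ST → ℂ} (hq : Continuous q) (hc : HasCompactSupport q) (z : ST) :
    Integrable fun y => newton y * q (z.1 + ‖y‖, z.2 - y) :=
  integrable_newton_mul (by fun_prop) (hasCompactSupport_cone hc z)

/-- The advanced potential of `□ g` is `g`. -/
theorem adv_box {g : ST → ℂ} (hg : ContDiff ℝ ∞ g) (hc : HasCompactSupport g) (z : ST) :
    adv (box g) z = g z := by
  have h2 : ContDiff ℝ 2 g := contDiff_infty.1 hg 2
  have hbox := contDiff_box hg
  have hg1 : ContDiff ℝ ∞ (fderiv ℝ g) := hg.fderiv_right (by simp)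
  have hg2 : ContDiff ℝ ∞ (fderiv ℝ (fderiv ℝ g)) := hg1.fderiv_right (by simp)
  have hg1c := hg1.continuous
  have hg2c := hg2.continuous
  have hgc := hg.continuous
  have hboxc := hbox.continuous
  rw [adv, integral_newton_mul (integrable_adv hbox.continuous (hasCompactSupport_box hc) z)]
  obtain ⟨t, x⟩ := z
  let γ : ℝ → E3 → ST := fun r η => (t + r, x - r • η)
  have hγ : ∀ r η, HasDerivAt (fun s => γ s η) (1, -η) r := fun r η =>
    ((hasDerivAt_id r).const_add t).prodMk
      (by simpa using ((hasDerivAt_id r).smul_const η).const_sub x)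
  have hγc : Continuous fun p : ℝ × E3 => γ p.1 p.2 := by fun_prop
  -- The primitive: its radial derivative `b'` along the cone has sphere integral `r ∫ □g`.
  -- Differentiation follows `(1, -η)` while `b` uses `(1, η)`, so the mixed second derivatives
  -- cancel and `∂ₜ²` minus the radial second derivative remains.
  let b : ℝ → E3 → ℂ := fun r η => r * fderiv ℝ g (γ r η) (1, η) - g (γ r η)
  let b' : ℝ → E3 → ℂ := fun r η => (2 * fderiv ℝ g (γ r η) (0, η)
    + (-r : ℝ) * fderiv ℝ (fderiv ℝ g) (γ r η) (0, η) (0, η))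
      + r * fderiv ℝ (fderiv ℝ g) (γ r η) (1, 0) (1, 0)
  have hb : ∀ r η, HasDerivAt (fun s => b s η) (b' r η) r := fun r η => by
    have e1 : HasDerivAt (fun s => g (γ s η)) (fderiv ℝ g (γ r η) (1, -η)) r :=
      (hg.differentiable (by simp) _).hasFDerivAt.comp_hasDerivAt r (hγ r η)
    have e2 : HasDerivAt (fun s => fderiv ℝ g (γ s η) (1, η))
        (fderiv ℝ (fderiv ℝ g) (γ r η) (1, -η) (1, η)) r := by
      have := ((hg1.differentiable (by simp) _).hasFDerivAt.comp_hasDerivAt r (hγ r η))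
      simpa using this.clm_apply (hasDerivAt_const r ((1, η) : ST))
    have e3 : HasDerivAt (fun r : ℝ => (r : ℂ)) 1 r := (hasDerivAt_id r).ofReal_comp
    refine ((e3.mul e2).sub e1).congr_deriv ?_
    have s1 : ((1, η) : ST) = (1, 0) + (0, η) := by simp
    have s2 : ((1, -η) : ST) = (1, 0) - (0, η) := by simp
    simp only [b', s1, s2, map_add, map_sub, sub_apply]
    rw [isSymm_fderiv_fderiv h2 (γ r η) (0, η) (1, 0)]
    push_cast
    ring
  have hb'c : Continuous (Function.uncurry b') := by
    simp only [b', Function.uncurry_def]; fun_prop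
  have hB := hasDerivAt_sphere_integral (F := b) (F' := b')
    (fun r => by simp only [b]; fun_prop) hb'c hb
  have hB' : ∀ r : ℝ, ∫ η : S2, b' r η ∂surf =
      ∫ η : S2, (r : ℂ) * box g (t + r, x - r • (η : E3)) ∂surf := by
    intro r
    have hf : ContDiff ℝ 2 fun y => g (t + r, y) := by fun_prop
    -- The radius is `-r` because the cone `γ` passes through `x - r η`.
    have hd := integral_sphere_darboux hf x (-r)
    have hs1 : ∀ y v, fderiv ℝ (fun y => g (t + r, y)) y v = fderiv ℝ g (t + r, y) (0, v) :=
      fun y v => by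
        have h := fderiv_comp_affine h2 (t + r, (0 : E3)) (ContinuousLinearMap.inr ℝ ℝ E3) y
        simp only [ContinuousLinearMap.inr_apply, Prod.mk_add_mk, zero_add, add_zero] at h
        rw [h]; simp
    have hs2 : ∀ y v, fderiv ℝ (fderiv ℝ (fun y => g (t + r, y))) y v v =
        fderiv ℝ (fderiv ℝ g) (t + r, y) (0, v) (0, v) := fun y v => by
      have h := fderiv_fderiv_comp_affine h2 (t + r, (0 : E3)) (ContinuousLinearMap.inr ℝ ℝ E3) y v v
      simpa only [ContinuousLinearMap.inr_apply, Prod.mk_add_mk, zero_add, add_zero] using h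
    simp only [laplacian_slice h2, hs1, hs2, neg_smul, ← sub_eq_add_neg] at hd
    simp only [b']
    have i1 : Integrable (fun η : S2 => 2 * fderiv ℝ g (γ r η) (0, (η : E3))
        + (-r : ℝ) * fderiv ℝ (fderiv ℝ g) (γ r η) (0, (η : E3)) (0, (η : E3))) surf :=
      integrable_sphere (f := fun η => 2 * fderiv ℝ g (γ r η) (0, η)
        + (-r : ℝ) * fderiv ℝ (fderiv ℝ g) (γ r η) (0, η) (0, η)) (by simp only [γ]; fun_prop)
    have i2 : Integrable (fun η : S2 =>
        r * fderiv ℝ (fderiv ℝ g) (γ r η) (1, 0) (1, 0)) surf :=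
      integrable_sphere (f := fun η => r * fderiv ℝ (fderiv ℝ g) (γ r η) (1, 0) (1, 0))
        (by simp only [γ]; fun_prop)
    have i3 : Integrable (fun η : S2 => ((-r : ℝ) : ℂ) * ∑ i, fderiv ℝ (fderiv ℝ g) (γ r η)
        (0, e3 i) (0, e3 i)) surf :=
      integrable_sphere (f := fun η => ((-r : ℝ) : ℂ) * ∑ i, fderiv ℝ (fderiv ℝ g) (γ r η)
        (0, e3 i) (0, e3 i)) (by simp only [γ]; fun_prop)
    rw [integral_add i1 i2]
    simp only [γ] at i1 i2 i3 ⊢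
    rw [hd, ← integral_add i3 i2]
    congr 1
    funext η
    simp only [box, dd_dd h2]
    push_cast
    ring
  obtain ⟨ρ, hρ⟩ := hc.isBounded.subset_closedBall 0
  have hout : ∀ (r : ℝ) (η : E3), ρ + |t| < |r| → γ r η ∉ tsupport g := fun r η hr hmem => by
    have h1 := hρ hmem
    rw [mem_closedBall_zero_iff] at h1
    have h3 : |t + r| ≤ ‖γ r η‖ := norm_fst_le (γ r η)
    have h4 : |r| ≤ |t + r| + |t| := by
      calc |r| = |(t + r) - t| := by ring_nf
        _ ≤ _ := abs_sub _ _
    linarith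
  have hbz : ∀ (r : ℝ) (η : E3), ρ + |t| < |r| → b r η = 0 ∧ b' r η = 0 := fun r η hr => by
    have hn := hout r η hr
    have z0 : g (γ r η) = 0 := image_eq_zero_of_notMem_tsupport hn
    have hn1 : γ r η ∉ tsupport (fderiv ℝ g) := fun h => hn (tsupport_fderiv_subset ℝ h)
    have z1 : fderiv ℝ g (γ r η) = 0 := image_eq_zero_of_notMem_tsupport hn1
    have z2 : fderiv ℝ (fderiv ℝ g) (γ r η) = 0 := image_eq_zero_of_notMem_tsupport
      fun h => hn1 (tsupport_fderiv_subset ℝ h)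
    simp [b, b', z0, z1, z2]
  have hI : Integrable fun r => ∫ η : S2, b' r η ∂surf := by
    refine (continuous_sphere_integral hb'c).integrable_of_hasCompactSupport ?_
    refine HasCompactSupport.intro (isCompact_closedBall (0 : ℝ) (ρ + |t|)) fun r hr => ?_
    have : ρ + |t| < |r| := by simpa using hr
    simp [hbz r _ this]
  have hlim : Tendsto (fun r => ∫ η : S2, b r η ∂surf) atTop (𝓝 0) := by
    refine tendsto_const_nhds.congr' ?_
    filter_upwards [eventually_gt_atTop (ρ + |t|)] with r hr
    have : ρ + |t| < |r| := hr.trans_le (le_abs_self r)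
    simp [hbz r _ this]
  have := integral_Ioi_of_hasDerivAt_of_tendsto' (a := 0) (fun r _ => hB r) hI.integrableOn hlim
  -- At infinity `b` vanishes by compact support, and at `r = 0` it equals `-g(t, x)`; the surface
  -- area `4π` cancels the constant of the weight.
  simp only [hB'] at this
  have hn : ∀ r ∈ Ioi (0 : ℝ), ∫ η : S2, r * box g ((t, x).1 + ‖r • (η : E3)‖,
      (t, x).2 - r • (η : E3)) ∂surf =
      ∫ η : S2, (r : ℂ) * box g (t + r, x - r • (η : E3)) ∂surf := fun r hr => by
    simp only [norm_smul, norm_coe_S2, mul_one, Real.norm_eq_abs, abs_of_pos (mem_Ioi.1 hr)]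
  rw [setIntegral_congr_fun measurableSet_Ioi hn, this]
  simp only [b, γ, Complex.ofReal_zero, zero_mul, zero_smul, add_zero, sub_zero, zero_sub,
    integral_neg, integral_const, surf_univ, Complex.real_smul, neg_neg]
  have hpi : (Real.pi : ℂ) ≠ 0 := by exact_mod_cast Real.pi_ne_zero
  push_cast
  field_simp

/-! ### Existence of the pressure through Kirchhoff's formula. -/

/-- Kirchhoff's formula for the pressure at time `t`. -/
def kirchhoff (h : E3 → ℂ) (t : ℝ) (x : E3) : ℂ :=
  (4 * Real.pi : ℂ)⁻¹ * ∫ η : S2, (h (x + t • (η : E3)) + t * fderiv ℝ h (x + t • (η : E3)) η) ∂surf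

/-- The spherical mean operator `t / (4π) ∫ h(x + t η) dS(η)`. -/
def sphMean (h : E3 → ℂ) (t : ℝ) (x : E3) : ℂ :=
  (4 * Real.pi : ℂ)⁻¹ * ∫ η : S2, t * h (x + t • (η : E3)) ∂surf

section

variable {h : E3 → ℂ}

theorem hasDerivAt_sphMean (hh : ContDiff ℝ ∞ h) (t : ℝ) (x : E3) :
    HasDerivAt (fun t => sphMean h t x) (kirchhoff h t x) t := by
  have hc := hh.continuous
  have hc1 : Continuous (fderiv ℝ h) := hh.continuous_fderiv (by simp)
  refine (hasDerivAt_sphere_integral (F := fun t η => t * h (x + t • η))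
    (F' := fun t η => h (x + t • η) + t * fderiv ℝ h (x + t • η) η) (fun t => by fun_prop)
    (by simp only [Function.uncurry_def]; fun_prop) (fun t η => ?_) t).const_mul _
  have e1 : HasDerivAt (fun r : ℝ => (r : ℂ)) 1 t := (hasDerivAt_id t).ofReal_comp
  have e2 : HasDerivAt (fun s : ℝ => x + s • η) η t := by
    simpa using ((hasDerivAt_id t).smul_const η).const_add x
  refine (e1.mul ((hh.differentiable (by simp) _).hasFDerivAt.comp_hasDerivAt t e2)).congr_deriv ?_
  simp

theorem continuous_kirchhoff (hh : ContDiff ℝ ∞ h) :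
    Continuous fun z : ST => kirchhoff h z.1 z.2 := by
  have hc := hh.continuous
  have hc1 : Continuous (fderiv ℝ h) := hh.continuous_fderiv (by simp)
  exact continuous_const.mul (continuous_sphere_integral
    (F := fun (z : ST) η => h (z.2 + z.1 • η) + z.1 * fderiv ℝ h (z.2 + z.1 • η) η)
    (by simp only [Function.uncurry_def]; fun_prop))

theorem continuous_sphMean (hc : Continuous h) : Continuous fun z : ST => sphMean h z.1 z.2 :=
  continuous_const.mul (continuous_sphere_integral
    (F := fun (z : ST) η => z.1 * h (z.2 + z.1 • η))
    (by simp only [Function.uncurry_def]; fun_prop))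

theorem sphMean_zero (x : E3) : sphMean h 0 x = 0 := by simp [sphMean]

/-- The causal solution of the wave equation with source `δ'(t) h(x)`. -/
def causalPressure (h : E3 → ℂ) (t : ℝ) (x : E3) : ℂ := if t < 0 then 0 else kirchhoff h t x

theorem causalPressure_eq_indicator (q : ST → ℂ) :
    (fun z : ST => causalPressure h z.1 z.2 * q z) =
      {z : ST | 0 ≤ z.1}.indicator fun z => kirchhoff h z.1 z.2 * q z := by
  funext z
  by_cases hz : z.1 < 0
  · simp [causalPressure, hz]
  · simp [causalPressure, hz, not_lt.1 hz]

theorem integrable_causalPressure_mul (hh : ContDiff ℝ ∞ h) {q : ST → ℂ} (hq : Continuous q)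
    (hc : HasCompactSupport q) : Integrable fun z : ST => causalPressure h z.1 z.2 * q z := by
  rw [causalPressure_eq_indicator]
  refine Integrable.indicator ?_ (measurableSet_le measurable_const measurable_fst)
  exact ((continuous_kirchhoff hh).mul hq).integrable_of_hasCompactSupport hc.mul_left

/-- Integration by parts in time; there is no boundary term because the spherical mean carries the
factor `t`. -/
theorem integral_kirchhoff_mul (hh : ContDiff ℝ ∞ h) {q : ST → ℂ} (hq : ContDiff ℝ ∞ q)
    (hc : HasCompactSupport q) (x : E3) :
    ∫ t in Ioi (0 : ℝ), kirchhoff h t x * q (t, x) =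
      -∫ t in Ioi (0 : ℝ), sphMean h t x * dd (1, 0) q (t, x) := by
  have hk : Continuous fun t => kirchhoff h t x := (continuous_kirchhoff hh).comp (by fun_prop :
    Continuous fun t : ℝ => ((t, x) : ST))
  have hs : Continuous fun t => sphMean h t x := (continuous_sphMean hh.continuous).comp
    (by fun_prop : Continuous fun t : ℝ => ((t, x) : ST))
  have hemb : Topology.IsClosedEmbedding fun t : ℝ => ((t, x) : ST) := by
    have hl : Function.LeftInverse (fun p : ST => p.1) (fun t : ℝ => ((t, x) : ST)) := fun y => by
      simp
    exact hl.isClosedEmbedding (by fun_prop) (by fun_prop)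
  have hqc := hq.continuous
  have hdc := (contDiff_dd hq (1, 0)).continuous
  have i1 : Integrable fun t => kirchhoff h t x * q (t, x) :=
    (hk.mul (by fun_prop : Continuous fun t : ℝ => q (t, x))).integrable_of_hasCompactSupport
      (hc.comp_isClosedEmbedding hemb).mul_left
  have i2 : Integrable fun t => sphMean h t x * dd (1, 0) q (t, x) :=
    (hs.mul (by fun_prop : Continuous fun t : ℝ => dd (1, 0) q (t, x))).integrable_of_hasCompactSupport
      ((hasCompactSupport_dd hc (1, 0)).comp_isClosedEmbedding hemb).mul_left
  have hder : ∀ t ∈ Ici (0 : ℝ), HasDerivAt (fun t => sphMean h t x * q (t, x))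
      (kirchhoff h t x * q (t, x) + sphMean h t x * dd (1, 0) q (t, x)) t := fun t _ =>
    (hasDerivAt_sphMean hh t x).mul (hasDerivAt_comp_dd hq (γ := fun t => (t, x))
      ((hasDerivAt_id t).prodMk (hasDerivAt_const t x)))
  have hcs : HasCompactSupport fun t => sphMean h t x * q (t, x) :=
    (hc.comp_isClosedEmbedding hemb).mul_left
  have hlim : Tendsto (fun t => sphMean h t x * q (t, x)) atTop (𝓝 0) :=
    hcs.is_zero_at_infty.mono_left atTop_le_cocompact
  have := integral_Ioi_of_hasDerivAt_of_tendsto' hder (i1.add i2).integrableOn hlim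
  rw [integral_add i1.integrableOn i2.integrableOn, sphMean_zero] at this
  simpa using eq_neg_of_add_eq_zero_left (by simpa using this)

/-- Polar coordinates `y = t η`: the Jacobian `t²` against the weight `1/(4π t)` leaves the factor
`t/(4π)` of the spherical mean. -/
theorem integral_Ioi_sphMean_mul {f : ℝ → ℂ} {x : E3}
    (hi : Integrable fun y => newton y * (h (x + y) * f ‖y‖)) :
    ∫ t in Ioi (0 : ℝ), sphMean h t x * f t = ∫ y, newton y * (h (x + y) * f ‖y‖) := by
  rw [integral_newton_mul (f := fun y => h (x + y) * f ‖y‖) hi, ← integral_const_mul]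
  refine setIntegral_congr_fun measurableSet_Ioi fun r hr => ?_
  simp only [sphMean, norm_smul, norm_coe_S2, mul_one, Real.norm_eq_abs, abs_of_pos (mem_Ioi.1 hr)]
  rw [mul_assoc, ← integral_mul_const]
  simp only [mul_assoc]

theorem locallyIntegrable_newton_snd :
    LocallyIntegrable fun z : E3 × E3 => newton z.2 := by
  rw [MeasureTheory.locallyIntegrable_iff]
  intro K hK
  have h1 : IntegrableOn (fun z : E3 × E3 => newton z.2)
      ((Prod.fst '' K) ×ˢ (Prod.snd '' K)) := by
    have : Integrable (fun z : E3 × E3 => (1 : ℂ) * newton z.2)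
        ((volume.restrict (Prod.fst '' K)).prod (volume.restrict (Prod.snd '' K))) :=
      Integrable.mul_prod (f := fun _ => (1 : ℂ)) (g := newton)
        (integrableOn_const (hK.image continuous_fst).measure_lt_top.ne)
        ((MeasureTheory.locallyIntegrable_iff.1 locallyIntegrable_newton) _
          (hK.image continuous_snd))
    rw [Measure.prod_restrict] at this
    simp only [one_mul] at this
    exact this
  exact h1.mono_set fun z hz => ⟨⟨z, hz, rfl⟩, ⟨z, hz, rfl⟩⟩

/-- Substituting `w = x + y` and applying Fubini makes spherical means and advanced potentials
adjoint: the inner integral on the right is `adv Q (0, x)`. -/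
theorem integral_newton_shear (hc : Continuous h) {Q : ST → ℂ} (hQ : Continuous Q)
    (hQc : HasCompactSupport Q) :
    ∫ x, ∫ y, newton y * (h (x + y) * Q (‖y‖, x)) =
      ∫ x, h x * ∫ y, newton y * Q (‖y‖, x - y) := by
  have hG : Integrable (fun z : E3 × E3 => newton z.2 * (h (z.1 + z.2) * Q (‖z.2‖, z.1))) := by
    refine locallyIntegrable_newton_snd.integrable_smul_right_of_hasCompactSupport
      (by fun_prop) ?_
    obtain ⟨ρ, hρ⟩ := hQc.isBounded.subset_closedBall 0
    refine HasCompactSupport.intro (isCompact_closedBall 0 ρ) fun z hz => ?_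
    have : (‖z.2‖, z.1) ∉ tsupport Q := fun hm => hz (by
      have := hρ hm
      rw [mem_closedBall_zero_iff, Prod.norm_def] at this ⊢
      simpa [max_comm] using this)
    simp [image_eq_zero_of_notMem_tsupport this]
  have hK : Integrable (fun z : E3 × E3 =>
      newton (z.2 - z.1) * (h z.2 * Q (‖z.2 - z.1‖, z.1))) := by
    have := (measurePreserving_prod_neg_add (volume : Measure E3) (volume : Measure E3)).integrable_comp_of_integrable hG
    refine this.congr (Eventually.of_forall fun z => ?_)
    simp [neg_add_eq_sub]
  calc _ = ∫ x, ∫ w, newton (w - x) * (h w * Q (‖w - x‖, x)) := by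
        congr 1; funext x
        rw [← integral_sub_right_eq_self _ x]
        simp
    _ = ∫ w, ∫ x, newton (w - x) * (h w * Q (‖w - x‖, x)) := integral_integral_swap hK
    _ = _ := by
        congr 1; funext w
        rw [← integral_sub_left_eq_self _ _ w, ← integral_const_mul]
        congr 1; funext y
        rw [sub_sub_cancel]; ring

theorem isPressure_causalPressure (hh : ContDiff ℝ ∞ h) : IsPressure h (causalPressure h) where
  causal t ht x := by simp [causalPressure, ht]
  continuousOn := by
    refine (continuous_kirchhoff hh).continuousOn.congr fun z hz => ?_
    simp [causalPressure, not_lt.2 (show 0 ≤ z.1 from hz)]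
  wave θ hθ hc := by
    have hq := contDiff_box hθ
    have hqc := hasCompactSupport_box hc
    have hQ := contDiff_dd hq (1, 0)
    have hQc := hasCompactSupport_dd hqc (1, 0)
    simp only [box_eq (contDiff_infty.1 hθ 2)]
    have hint := integrable_causalPressure_mul hh hq.continuous hqc
    rw [Measure.volume_eq_prod] at hint ⊢
    rw [integral_prod_symm _ hint]
    have h1 : ∀ x, ∫ t, causalPressure h t x * box θ (t, x) =
        -∫ y, newton y * (h (x + y) * dd (1, 0) (box θ) (‖y‖, x)) := fun x => by
      have e : (fun t => causalPressure h t x * box θ (t, x)) =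
          (Ici (0 : ℝ)).indicator fun t => kirchhoff h t x * box θ (t, x) := by
        funext t
        exact congrFun (causalPressure_eq_indicator (h := h) (box θ)) (t, x)
      rw [e, integral_indicator measurableSet_Ici, integral_Ici_eq_integral_Ioi,
        integral_kirchhoff_mul hh hq hqc,
        integral_Ioi_sphMean_mul (f := fun t => dd (1, 0) (box θ) (t, x))]
      refine integrable_newton_mul ?_ ?_
      · have := hh.continuous
        have := hQ.continuous
        fun_prop
      · obtain ⟨ρ, hρ⟩ := hQc.isBounded.subset_closedBall 0
        refine HasCompactSupport.intro (isCompact_closedBall 0 ρ) fun y hy => ?_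
        have : (‖y‖, x) ∉ tsupport (dd (1, 0) (box θ)) := fun hm => hy (by
          have := (norm_fst_le _).trans (mem_closedBall_zero_iff.1 (hρ hm))
          simpa using this)
        simp [image_eq_zero_of_notMem_tsupport this]
    simp only [h1]
    rw [integral_neg, integral_newton_shear hh.continuous hQ.continuous hQc]
    congr 2
    funext x
    -- The test function is `∂ₜθ`: since `∂ₜ` commutes with `□`, the advanced potential of `∂ₜ □ θ`
    -- at time zero is `∂ₜθ(0, x)`.
    have h2 := adv_box (contDiff_dd hθ (1, 0)) (hasCompactSupport_dd hc (1, 0)) (0, x)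
    rw [box_dd_comm hθ] at h2
    simp only [adv, zero_add] at h2
    rw [h2]
    congr 1
    exact (hasDerivAt_comp_dd hθ (γ := fun t => (t, x)) (t := 0)
      ((hasDerivAt_id (0 : ℝ)).prodMk (hasDerivAt_const 0 x))).deriv.symm

end

/-! ### Uniqueness of the pressure by duality, and the formula for `R`. -/

/-- Pushing Lebesgue measure onto the backward light cone `{(-|y|, y)}` turns `adv` into a
convolution, so that smoothness passes from `q` to `adv q`. -/
theorem adv_eq_convolution (q : ST → ℂ) :
    adv q = convolution (fun w : ST => newton w.2) q (ContinuousLinearMap.mul ℝ ℂ)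
      ((volume : Measure E3).map fun y => ((-‖y‖, y) : ST)) := by
  have hl : Function.LeftInverse (fun p : ST => p.2) (fun y : E3 => ((-‖y‖, y) : ST)) := fun y => rfl
  have he := (hl.isClosedEmbedding (by fun_prop) (by fun_prop)).measurableEmbedding
  funext z
  rw [convolution_def, he.integral_map]
  simp only [adv, ContinuousLinearMap.mul_apply']
  congr 1; funext y
  congr 2
  ext <;> simp

theorem contDiff_adv {q : ST → ℂ} (hq : ContDiff ℝ ∞ q) (hc : HasCompactSupport q) :
    ContDiff ℝ ∞ (adv q) := by
  rw [adv_eq_convolution]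
  refine hc.contDiff_convolution_right (n := ⊤) _ ?_ hq
  have hl : Function.LeftInverse (fun p : ST => p.2) (fun y : E3 => ((-‖y‖, y) : ST)) := fun y => rfl
  have he := hl.isClosedEmbedding (by fun_prop) (by fun_prop)
  rw [MeasureTheory.locallyIntegrable_iff]
  intro K hK
  rw [he.measurableEmbedding.integrableOn_map_iff]
  exact (MeasureTheory.locallyIntegrable_iff.1 locallyIntegrable_newton) _ (he.isCompact_preimage hK)

theorem dd_adv {q : ST → ℂ} (hq : ContDiff ℝ ∞ q) (hc : HasCompactSupport q) (v : ST) :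
    dd v (adv q) = adv (dd v q) := by
  funext z
  have hq' := contDiff_dd hq v
  have hc' := hasCompactSupport_dd hc v
  obtain ⟨C, hC⟩ := hq'.continuous.bounded_above_of_compact_support hc'
  obtain ⟨ρ, hρ⟩ := hc'.isBounded.subset_closedBall 0
  let F : ℝ → E3 → ℂ := fun s y => newton y * q ((z + s • v).1 + ‖y‖, (z + s • v).2 - y)
  let F' : ℝ → E3 → ℂ := fun s y => newton y * dd v q ((z + s • v).1 + ‖y‖, (z + s • v).2 - y)
  -- For `|s| < 1` the base point `z + s v` stays within `‖z‖ + ‖v‖` of the origin, so the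
  -- integrands vanish outside one fixed ball.
  let bd : E3 → ℝ := (closedBall (0 : E3) (ρ + ‖z‖ + ‖v‖)).indicator fun y => ‖newton y‖ * C
  have hline : HasDerivAt (fun s : ℝ => z + s • v) v 0 := by
    simpa using ((hasDerivAt_id (0 : ℝ)).smul_const v).const_add z
  have key : HasDerivAt (fun s => ∫ y, F s y) (∫ y, F' 0 y) 0 := by
    refine (hasDerivAt_integral_of_dominated_loc_of_deriv_le (bound := bd) (ball_mem_nhds 0 one_pos)
      (Eventually.of_forall fun s => (integrable_adv hq.continuous hc _).aestronglyMeasurable)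
      (integrable_adv hq.continuous hc _)
      (integrable_adv hq'.continuous hc' _).aestronglyMeasurable
      (Eventually.of_forall fun y s hs => ?_) ?_ (Eventually.of_forall fun y s _ => ?_)).2
    · by_cases hy : y ∈ closedBall (0 : E3) (ρ + ‖z‖ + ‖v‖)
      · simp only [bd, indicator_of_mem hy, F', norm_mul]
        gcongr
        exact hC _
      · have : ((z + s • v).1 + ‖y‖, (z + s • v).2 - y) ∉ tsupport (dd v q) := fun hm => hy (by
          have h1 := (norm_snd_le _).trans (mem_closedBall_zero_iff.1 (hρ hm))
          have h2 : ‖(z + s • v).2‖ ≤ ‖z‖ + ‖v‖ := by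
            refine (norm_snd_le _).trans ((norm_add_le _ _).trans ?_)
            rw [norm_smul]
            have : ‖s‖ ≤ 1 := (mem_ball_zero_iff.1 hs).le
            nlinarith [norm_nonneg v]
          have h3 : ‖y‖ ≤ ‖(z + s • v).2‖ + ‖(z + s • v).2 - y‖ := by
            calc ‖y‖ = ‖(z + s • v).2 - ((z + s • v).2 - y)‖ := by congr 1; abel
              _ ≤ _ := norm_sub_le _ _
          rw [mem_closedBall_zero_iff]
          dsimp only at h1
          linarith)
        simp only [bd, indicator_of_notMem hy, F', image_eq_zero_of_notMem_tsupport this]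
        simp
    · rw [integrable_indicator_iff measurableSet_closedBall]
      exact (((MeasureTheory.locallyIntegrable_iff.1 locallyIntegrable_newton) _
        (isCompact_closedBall _ _)).norm).mul_const C
    · refine HasDerivAt.const_mul (newton y) (hasDerivAt_comp_dd hq
        (γ := fun s => ((z + s • v).1 + ‖y‖, (z + s • v).2 - y)) ?_)
      have hl : HasDerivAt (fun s : ℝ => (z + s • v) + ((‖y‖, -y) : ST)) v s := by
        simpa using (((hasDerivAt_id s).smul_const v).const_add z).add_const ((‖y‖, -y) : ST)
      have e : (fun s : ℝ => (((z + s • v).1 + ‖y‖, (z + s • v).2 - y) : ST)) =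
          fun s => (z + s • v) + ((‖y‖, -y) : ST) := by
        funext s; ext <;> simp [sub_eq_add_neg]
      rw [e]
      exact hl
  have h2 : HasDerivAt (fun s : ℝ => adv q (z + s • v)) (dd v (adv q) (z + (0 : ℝ) • v)) 0 :=
    hasDerivAt_comp_dd (contDiff_adv hq hc) hline
  simpa [F', adv] using h2.unique key

theorem box_adv {q : ST → ℂ} (hq : ContDiff ℝ ∞ q) (hc : HasCompactSupport q) :
    box (adv q) = q := by
  have h : ∀ v, dd v (dd v (adv q)) = adv (dd v (dd v q)) := fun v => by
    rw [dd_adv hq hc, dd_adv (contDiff_dd hq v) (hasCompactSupport_dd hc v)]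
  have hi : ∀ v z : ST, Integrable fun y => newton y * dd v (dd v q) (z.1 + ‖y‖, z.2 - y) := fun v z =>
    integrable_adv (contDiff_dd (contDiff_dd hq v) v).continuous
      (hasCompactSupport_dd (hasCompactSupport_dd hc v) v) z
  funext z
  rw [← adv_box hq hc z]
  simp only [box, h, adv, mul_sub, Finset.mul_sum]
  rw [integral_sub (hi _ _) (integrable_finsetSum _ fun i _ => hi _ _),
    integral_finsetSum _ fun i _ => hi _ _]

theorem box_congr {f g : ST → ℂ} {z : ST} (h : f =ᶠ[𝓝 z] g) : box f z = box g z := by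
  have h1 : ∀ {f g : ST → ℂ} {z : ST} (v : ST), f =ᶠ[𝓝 z] g → dd v f =ᶠ[𝓝 z] dd v g :=
    fun v h => (h.fderiv (𝕜 := ℝ)).fun_comp fun L => L v
  simp only [box, ((h1 _ (h1 _ h)).eq_of_nhds)]

/-- Every smooth compactly supported function agrees, for positive times, with the wave operator
applied to a test function. -/
theorem exists_box_eq {g : ST → ℂ} (hg : ContDiff ℝ ∞ g) (hc : HasCompactSupport g) :
    ∃ θ : ST → ℂ, ContDiff ℝ ∞ θ ∧ HasCompactSupport θ ∧ ∀ z : ST, 0 ≤ z.1 → box θ z = g z := by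
  -- The advanced potential already vanishes for late times; `χ` cuts off the past. It is `0` for `t
  -- ≤ -1` and `1` for `t ≥ -1/2`, so near any point with `t ≥ 0` it does not affect `□`.
  let χ : ℝ → ℝ := fun t => Real.smoothTransition (2 * t + 2)
  have hχ : ContDiff ℝ ∞ χ := Real.smoothTransition.contDiff.comp (by fun_prop)
  refine ⟨fun z => (χ z.1 : ℂ) * adv g z, ?_, ?_, ?_⟩
  · have := contDiff_adv hg hc
    have h2 : ContDiff ℝ ∞ fun z : ST => (χ z.1 : ℂ) :=
      Complex.ofRealCLM.contDiff.comp (hχ.comp contDiff_fst)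
    exact h2.mul this
  · obtain ⟨ρ, hρ⟩ := hc.isBounded.subset_closedBall 0
    -- If `t > -1` and `(t + |y|, x - y)` meets the support, then `|y| ≤ ρ + 1` and `|x| ≤ 2ρ + 1`.
    refine HasCompactSupport.intro (isCompact_closedBall 0 (2 * ρ + 1)) fun z hz => ?_
    by_cases ht : z.1 ≤ -1
    · have : χ z.1 = 0 := Real.smoothTransition.zero_of_nonpos (by linarith)
      simp [this]
    · have h0 : ∀ y : E3, g (z.1 + ‖y‖, z.2 - y) = 0 := fun y => by
        refine image_eq_zero_of_notMem_tsupport fun hm => hz ?_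
        have hm' := mem_closedBall_zero_iff.1 (hρ hm)
        have h1 := abs_le.1 ((norm_fst_le _).trans hm')
        have h2 := (norm_snd_le _).trans hm'
        have h3 : ‖z.2‖ ≤ ‖z.2 - y‖ + ‖y‖ := by
          calc ‖z.2‖ = ‖(z.2 - y) + y‖ := by rw [sub_add_cancel]
            _ ≤ _ := norm_add_le _ _
        have h4 := norm_nonneg y
        dsimp only at h1 h2
        rw [mem_closedBall_zero_iff, Prod.norm_def, max_le_iff, Real.norm_eq_abs, abs_le]
        refine ⟨⟨?_, ?_⟩, ?_⟩ <;> linarith [not_le.1 ht]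
      simp [adv, h0]
  · intro z hz
    rw [← congrFun (box_adv hg hc) z]
    refine box_congr ?_
    have : ∀ᶠ w : ST in 𝓝 z, -(1 / 2) < w.1 :=
      (continuous_fst.tendsto z).eventually (lt_mem_nhds (by linarith))
    filter_upwards [this] with w hw
    have : χ w.1 = 1 := Real.smoothTransition.one_of_one_le (by linarith)
    simp [this]

section

variable {h : E3 → ℂ} {p p' : ℝ → E3 → ℂ}

theorem IsPressure.locallyIntegrable (hp : IsPressure h p) :
    LocallyIntegrable fun z : ST => p z.1 z.2 := by
  rw [MeasureTheory.locallyIntegrable_iff]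
  intro K hK
  have hcl : IsClosed {z : ST | 0 ≤ z.1} := isClosed_le continuous_const continuous_fst
  have h1 : IntegrableOn (fun z : ST => p z.1 z.2) (K ∩ {z : ST | 0 ≤ z.1}) :=
    (hp.continuousOn.mono inter_subset_right).integrableOn_compact (hK.inter_right hcl)
  have h2 : (fun z : ST => p z.1 z.2) = {z : ST | 0 ≤ z.1}.indicator fun z => p z.1 z.2 := by
    funext z
    by_cases hz : 0 ≤ z.1
    · simp [hz]
    · simp [hz, hp.causal z.1 (not_le.1 hz)]
  rw [h2, IntegrableOn, integrable_indicator_iff hcl.measurableSet, IntegrableOn,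
    Measure.restrict_restrict hcl.measurableSet, inter_comm]
  exact h1

theorem IsPressure.integral_mul_eq (hp : IsPressure h p) (hp' : IsPressure h p') {g : ST → ℂ}
    (hg : ContDiff ℝ ∞ g) (hc : HasCompactSupport g) :
    ∫ z : ST, p z.1 z.2 * g z = ∫ z : ST, p' z.1 z.2 * g z := by
  obtain ⟨θ, hθ, hθc, hbox⟩ := exists_box_eq hg hc
  have e : ∀ {p : ℝ → E3 → ℂ}, IsPressure h p → ∫ z : ST, p z.1 z.2 * g z =
      -∫ x : E3, h x * deriv (fun t => θ (t, x)) 0 := fun {p} hp => by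
    rw [← hp.wave θ hθ hθc]
    congr 1; funext z
    by_cases hz : 0 ≤ z.1
    · rw [box_eq (contDiff_infty.1 hθ 2), hbox z hz]
    · simp [hp.causal z.1 (not_le.1 hz)]
  rw [e hp, e hp']

/-- Equal pairings with all test functions give equality almost everywhere. Continuity upgrades this
to every point with `t ≥ 0`, that set being in the closure of its interior, and causality settles `t
< 0`. -/
theorem IsPressure.unique (hp : IsPressure h p) (hp' : IsPressure h p') : p = p' := by
  have hae : ∀ᵐ z : ST, p z.1 z.2 - p' z.1 z.2 = 0 := by
    refine ae_eq_zero_of_integral_contDiff_smul_eq_zero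
      (hp.locallyIntegrable.sub hp'.locallyIntegrable) fun g hg hc => ?_
    have hg' : ContDiff ℝ ∞ fun z => (g z : ℂ) := Complex.ofRealCLM.contDiff.comp hg
    have hc' : HasCompactSupport fun z => (g z : ℂ) := hc.comp_left (g := Complex.ofReal) rfl
    have hi : ∀ {p : ℝ → E3 → ℂ}, IsPressure h p →
        Integrable fun z : ST => p z.1 z.2 * (g z : ℂ) := fun hp =>
      (hp.locallyIntegrable.integrable_smul_left_of_hasCompactSupport hg'.continuous hc').congr
        (Eventually.of_forall fun z => mul_comm _ _)
    have := sub_eq_zero.2 (hp.integral_mul_eq hp' hg' hc')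
    rw [← integral_sub (hi hp) (hi hp')] at this
    rw [← this]
    congr 1; funext z
    simp [mul_sub, mul_comm]
  have hcl : {z : ST | 0 ≤ z.1} ⊆ closure (interior {z : ST | 0 ≤ z.1}) := by
    have : {z : ST | 0 ≤ z.1} = Ici (0 : ℝ) ×ˢ univ := by ext; simp
    rw [this, interior_prod_eq, interior_Ici, closure_prod_eq, closure_Ioi]
    simp
  have heq : EqOn (fun z : ST => p z.1 z.2) (fun z => p' z.1 z.2) {z : ST | 0 ≤ z.1} :=
    Measure.eqOn_of_ae_eq (ae_restrict_of_ae (hae.mono fun z hz => sub_eq_zero.1 hz))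
      hp.continuousOn hp'.continuousOn hcl
  funext t x
  by_cases ht : 0 ≤ t
  · exact heq (x := (t, x)) ht
  · rw [hp.causal t (not_le.1 ht), hp'.causal t (not_le.1 ht)]

theorem pressure_eq (hh : ContDiff ℝ ∞ h) : pressure h = causalPressure h :=
  (Classical.epsilon_spec (p := IsPressure h) ⟨_, isPressure_causalPressure hh⟩).unique
    (isPressure_causalPressure hh)

theorem R_of_nonneg (hh : ContDiff ℝ ∞ h) {t : ℝ} (ht : 0 ≤ t) (ξ : E2) :
    R h t ξ = sphMean h t (pt ξ 0) := by
  have hk : Continuous fun τ => kirchhoff h τ (pt ξ 0) := (continuous_kirchhoff hh).comp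
    (by fun_prop : Continuous fun t : ℝ => ((t, pt ξ 0) : ST))
  have e : (fun τ => causalPressure h τ (pt ξ 0)) =
      (Ici (0 : ℝ)).indicator fun τ => kirchhoff h τ (pt ξ 0) := by
    funext τ
    by_cases hτ : τ < 0
    · simp [causalPressure, hτ]
    · simp [causalPressure, hτ, not_lt.1 hτ]
  rw [R, pressure_eq hh, e, setIntegral_indicator measurableSet_Ici, inter_comm, Ici_inter_Iic,
    integral_Icc_eq_integral_Ioc, ← intervalIntegral.integral_of_le ht,
    intervalIntegral.integral_eq_sub_of_hasDerivAt (fun τ _ => hasDerivAt_sphMean hh τ _)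
      (hk.intervalIntegrable _ _), sphMean_zero, sub_zero]

end

/-! ### A criterion for continuity of operators into Schwartz space. -/

section family

variable {ι V E : Type*} [AddCommGroup V] [Module ℂ V] [TopologicalSpace V]
  [NormedAddCommGroup E] [NormedSpace ℝ E] {f : ι → V → E → ℂ}

/-- Bootstrapping: each derivative is a finite combination of members of the same family, so `n`
derivatives for all members give `n + 1` for each. -/
theorem contDiff_of_family
    (hder : ∀ i, ∃ (N : ℕ) (j : Fin N → ι) (D : Fin N → V →L[ℂ] V)
      (L : Fin N → ℂ →L[ℝ] E →L[ℝ] ℂ),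
      ∀ v x, HasFDerivAt (f i v) (∑ a, L a (f (j a) (D a v) x)) x) (i : ι) (v : V) :
    ContDiff ℝ ∞ (f i v) := by
  rw [contDiff_infty]
  intro n
  induction n generalizing i v with
  | zero =>
    obtain ⟨N, j, D, L, h⟩ := hder i
    exact contDiff_zero.2 (continuous_iff_continuousAt.2 fun x => (h v x).continuousAt)
  | succ n ih =>
    obtain ⟨N, j, D, L, h⟩ := hder i
    have e : fderiv ℝ (f i v) = fun x => ∑ a, L a (f (j a) (D a v) x) :=
      funext fun x => (h v x).fderiv
    rw [Nat.cast_succ]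
    refine contDiff_succ_iff_fderiv.2 ⟨fun x => (h v x).differentiableAt, by simp, ?_⟩
    rw [e]
    exact ContDiff.sum fun a _ => (L a).contDiff.comp (ih (j a) (D a v))

/-- A family of functions depending on a vector of a topological vector space whose members decay
rapidly, and whose derivatives are expressed by the family itself, has rapidly decaying
derivatives of all orders. -/
theorem decay_of_family
    (hdecay : ∀ i (k : ℕ), ∃ p : Seminorm ℂ V, Continuous p ∧ ∀ v x, ‖x‖ ^ k * ‖f i v x‖ ≤ p v)
    (hder : ∀ i, ∃ (N : ℕ) (j : Fin N → ι) (D : Fin N → V →L[ℂ] V)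
      (L : Fin N → ℂ →L[ℝ] E →L[ℝ] ℂ),
      ∀ v x, HasFDerivAt (f i v) (∑ a, L a (f (j a) (D a v) x)) x) (n : ℕ) (i : ι) (k : ℕ) :
    ∃ p : Seminorm ℂ V, Continuous p ∧
      ∀ v x, ‖x‖ ^ k * ‖iteratedFDeriv ℝ n (f i v) x‖ ≤ p v := by
  have hsm := contDiff_of_family hder
  induction n generalizing i with
  | zero => simpa using hdecay i k
  | succ n ih =>
    obtain ⟨N, j, D, L, h⟩ := hder i
    choose p hp hb using fun a => ih (j a)
    refine ⟨∑ a, ‖L a‖₊ • (p a).comp (D a : V →ₗ[ℂ] V),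
      Seminorm.continuous_finsetSum fun a _ => ?_, fun v x => ?_⟩
    · exact ((hp a).comp (D a).continuous).const_smul ‖L a‖₊
    · have e : fderiv ℝ (f i v) = fun x => ∑ a, L a (f (j a) (D a v) x) :=
        funext fun x => (h v x).fderiv
      have hc : ∀ a, ContDiff ℝ ∞ (f (j a) (D a v)) := fun a => hsm (j a) (D a v)
      rw [← norm_iteratedFDeriv_fderiv, e, iteratedFDeriv_fun_sum_apply
        (f := fun a x => L a (f (j a) (D a v) x)) fun a _ => ((L a).contDiff.comp (contDiff_infty.1 (hc a) n)).contDiffAt, sum_apply]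
      calc _ ≤ ‖x‖ ^ k * ∑ a, ‖L a‖ * ‖iteratedFDeriv ℝ n (f (j a) (D a v)) x‖ := by
            gcongr
            refine (norm_sum_le _ _).trans (Finset.sum_le_sum fun a _ => ?_)
            exact (L a).norm_iteratedFDeriv_comp_left (contDiff_infty.1 (hc a) n).contDiffAt le_rfl
        _ = ∑ a, ‖L a‖ * (‖x‖ ^ k * ‖iteratedFDeriv ℝ n (f (j a) (D a v)) x‖) := by
            rw [Finset.mul_sum]
            exact Finset.sum_congr rfl fun a _ => by ring
        _ ≤ _ := Finset.sum_le_sum fun a _ => by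
            simp only [smul_apply, NNReal.smul_def, coe_nnnorm, smul_eq_mul,
              Seminorm.comp_apply]
            exact mul_le_mul_of_nonneg_left (hb a (D a v) x) (L a).opNorm_nonneg

theorem exists_schwartz_of_family [IsTopologicalAddGroup V]
    (hadd : ∀ i v w x, f i (v + w) x = f i v x + f i w x)
    (hsmul : ∀ i (c : ℂ) v x, f i (c • v) x = c * f i v x)
    (hdecay : ∀ i (k : ℕ), ∃ p : Seminorm ℂ V, Continuous p ∧ ∀ v x, ‖x‖ ^ k * ‖f i v x‖ ≤ p v)
    (hder : ∀ i, ∃ (N : ℕ) (j : Fin N → ι) (D : Fin N → V →L[ℂ] V)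
      (L : Fin N → ℂ →L[ℝ] E →L[ℝ] ℂ),
      ∀ v x, HasFDerivAt (f i v) (∑ a, L a (f (j a) (D a v) x)) x) (i : ι) :
    ∃ T : V →L[ℂ] 𝓢(E, ℂ), ∀ v x, T v x = f i v x := by
  have hd := decay_of_family hdecay hder
  let T : V →ₗ[ℂ] 𝓢(E, ℂ) :=
    { toFun := fun v =>
        { toFun := f i v
          smooth' := contDiff_of_family hder i v
          decay' := fun k n => by
            obtain ⟨p, -, hb⟩ := hd n i k
            exact ⟨p v, hb v⟩ }
      map_add' := fun v w => by ext x; exact hadd i v w x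
      map_smul' := fun c v => by ext x; exact hsmul i c v x }
  refine ⟨⟨T, ?_⟩, fun v x => rfl⟩
  refine (schwartz_withSeminorms ℂ E ℂ).continuous_of_continuous_comp T fun m => ?_
  obtain ⟨p, hp, hb⟩ := hd m.2 i m.1
  refine Seminorm.continuous_of_le hp fun v => ?_
  exact SchwartzMap.seminorm_le_bound ℂ m.1 m.2 (T v) (apply_nonneg p v) (hb v)

end family

/-! ### Vanishing to infinite order at `t = 0`. -/

section flat

theorem SchwartzTime.eq_zero (φ : SchwartzTime) {t : ℝ} (ht : t ≤ 0) (ξ : E2) :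
    φ.1 (t, ξ) = 0 := by
  have hneg : ∀ t < 0, φ.1 (t, ξ) = 0 := fun t ht =>
    image_eq_zero_of_notMem_tsupport fun h => (not_le.2 ht) (φ.2 h)
  have hc : Continuous fun t : ℝ => φ.1 (t, ξ) := φ.1.continuous.comp (by fun_prop)
  have : Iic (0 : ℝ) ⊆ {t | φ.1 (t, ξ) = 0} := by
    rw [← closure_Iio]
    exact closure_minimal hneg (isClosed_eq hc continuous_const)
  exact this ht

/-- The directional derivative on `𝓢(ℝ⁺ × ℝ²)`. -/
def SchwartzTime.deriv (v : ℝ × E2) : SchwartzTime →L[ℂ] SchwartzTime :=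
  ((LineDeriv.lineDerivOpCLM ℂ 𝓢(ℝ × E2, ℂ) v).comp SchwartzTime.subtypeL).codRestrict SchwartzTime
    fun φ => (SchwartzMap.tsupport_lineDerivOp_subset v φ.1).trans φ.2

theorem SchwartzTime.deriv_apply (v : ℝ × E2) (φ : SchwartzTime) (z : ℝ × E2) :
    (SchwartzTime.deriv v φ).1 z = fderiv ℝ φ.1 z v :=
  SchwartzMap.lineDerivOp_apply_eq_fderiv v φ.1 z

theorem SchwartzTime.exists_bound_zero (k : ℕ) :
    ∃ p : Seminorm ℂ SchwartzTime, Continuous p ∧ ∀ (φ : SchwartzTime) (t : ℝ) (ξ : E2), 0 ≤ t →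
      (1 + t + ‖ξ‖) ^ k * ‖φ.1 (t, ξ)‖ ≤ p φ := by
  let s : Seminorm ℂ 𝓢(ℝ × E2, ℂ) := (Finset.Iic (k, 0)).sup (schwartzSeminormFamily ℂ (ℝ × E2) ℂ)
  have hs : Continuous s := Seminorm.continuous_finsetSup fun i _ =>
    (schwartz_withSeminorms ℂ (ℝ × E2) ℂ).continuous_seminorm i
  -- One `2 ^ k` compares `1 + t + ‖ξ‖` with the maximum norm of `(t, ξ)`; the other is the constant
  -- in the seminorm estimate.
  refine ⟨((2 : NNReal) ^ k * 2 ^ k) • s.comp SchwartzTime.subtype,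
    (hs.comp continuous_subtype_val).const_smul _, fun φ t ξ ht => ?_⟩
  have h1 := SchwartzMap.one_add_le_sup_seminorm_apply (𝕜 := ℂ) (m := (k, 0)) le_rfl le_rfl φ.1 (t, ξ)
  rw [norm_iteratedFDeriv_zero] at h1
  have h2 : 1 + t + ‖ξ‖ ≤ 2 * (1 + ‖((t, ξ) : ℝ × E2)‖) := by
    have := norm_fst_le ((t, ξ) : ℝ × E2)
    have := norm_snd_le ((t, ξ) : ℝ × E2)
    simp only [Real.norm_eq_abs, abs_of_nonneg ht] at *
    linarith
  have h3 : 0 ≤ 1 + t + ‖ξ‖ := by positivity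
  calc (1 + t + ‖ξ‖) ^ k * ‖φ.1 (t, ξ)‖ ≤ (2 * (1 + ‖((t, ξ) : ℝ × E2)‖)) ^ k * ‖φ.1 (t, ξ)‖ := by
        gcongr
    _ = 2 ^ k * ((1 + ‖((t, ξ) : ℝ × E2)‖) ^ k * ‖φ.1 (t, ξ)‖) := by rw [mul_pow]; ring
    _ ≤ 2 ^ k * (2 ^ k * s φ.1) := mul_le_mul_of_nonneg_left h1 (by positivity)
    _ = _ := by
      simp [NNReal.smul_def, mul_assoc]

/-- Elements of `𝓢(ℝ⁺ × ℝ²)` vanish to infinite order at `t = 0`. -/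
theorem SchwartzTime.exists_bound (k l : ℕ) :
    ∃ p : Seminorm ℂ SchwartzTime, Continuous p ∧ ∀ (φ : SchwartzTime) (t : ℝ) (ξ : E2), 0 ≤ t →
      (1 + t + ‖ξ‖) ^ k * ‖φ.1 (t, ξ)‖ ≤ p φ * t ^ l := by
  induction l with
  | zero => simpa using exists_bound_zero k
  | succ l ih =>
    obtain ⟨p₀, hp₀, hb₀⟩ := exists_bound_zero k
    obtain ⟨p, hp, hb⟩ := ih
    refine ⟨p₀ + ((2 : NNReal) ^ k) • p.comp (SchwartzTime.deriv (1, 0) : SchwartzTime →ₗ[ℂ] SchwartzTime),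
      hp₀.add ((hp.comp (SchwartzTime.deriv (1, 0)).continuous).const_smul _), fun φ t ξ ht => ?_⟩
    simp only [add_apply, smul_apply, NNReal.smul_def, smul_eq_mul,
      Seminorm.comp_apply, NNReal.coe_pow, NNReal.coe_ofNat, ContinuousLinearMap.coe_coe]
    set ψ := SchwartzTime.deriv (1, 0) φ with hψ
    have n0 : 0 ≤ p₀ φ := apply_nonneg p₀ φ
    have n1 : 0 ≤ p ψ := apply_nonneg p ψ
    -- For `t ≥ 1` the extra power of `t` only weakens the bound. For `t < 1` it is gained by the
    -- mean value inequality on `[0, t]` from `φ(0, ξ) = 0` and the inductive bound for `∂ₜφ`.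
    by_cases h1 : 1 ≤ t
    · calc _ ≤ p₀ φ := hb₀ φ t ξ ht
        _ ≤ p₀ φ * t ^ (l + 1) := le_mul_of_one_le_right n0 (one_le_pow₀ h1)
        _ ≤ _ := by gcongr; linarith [mul_nonneg (pow_nonneg zero_le_two k : (0 : ℝ) ≤ 2 ^ k) n1]
    · have h1 := not_le.1 h1
      have hx : (0 : ℝ) < (1 + ‖ξ‖) ^ k := by positivity
      have hd : ∀ τ ∈ Icc 0 t, ‖ψ.1 (τ, ξ)‖ ≤ p ψ * t ^ l / (1 + ‖ξ‖) ^ k := fun τ hτ => by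
        rw [le_div_iff₀ hx, mul_comm]
        calc (1 + ‖ξ‖) ^ k * ‖ψ.1 (τ, ξ)‖ ≤ (1 + τ + ‖ξ‖) ^ k * ‖ψ.1 (τ, ξ)‖ := by
              gcongr; linarith [hτ.1]
          _ ≤ p ψ * τ ^ l := hb ψ τ ξ hτ.1
          _ ≤ p ψ * t ^ l := by gcongr; exacts [hτ.1, hτ.2]
      have hder : ∀ τ ∈ Icc 0 t, HasDerivWithinAt (fun τ => φ.1 (τ, ξ)) (ψ.1 (τ, ξ)) (Icc 0 t) τ :=
        fun τ _ => by
          rw [hψ, SchwartzTime.deriv_apply]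
          exact ((φ.1.hasFDerivAt (τ, ξ)).comp_hasDerivAt τ
            ((hasDerivAt_id τ).prodMk (hasDerivAt_const τ ξ))).hasDerivWithinAt
      have hm := norm_image_sub_le_of_norm_deriv_le_segment' hder
        (fun τ hτ => hd τ (Ico_subset_Icc_self hτ)) t (right_mem_Icc.2 ht)
      rw [SchwartzTime.eq_zero φ le_rfl, sub_zero, sub_zero] at hm
      calc (1 + t + ‖ξ‖) ^ k * ‖φ.1 (t, ξ)‖ ≤
            (2 * (1 + ‖ξ‖)) ^ k * (p ψ * t ^ l / (1 + ‖ξ‖) ^ k * t) := by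
            gcongr; linarith [norm_nonneg ξ]
        _ = 2 ^ k * p ψ * t ^ (l + 1) := by rw [mul_pow, pow_succ t]; field_simp
        _ ≤ _ := by gcongr; linarith

end flat

/-! ### Back-projection is continuous into Schwartz space. -/

/-- The projection `x ↦ x₁₂` of `ℝ³` onto `ℝ²`. -/
def pr : E3 →L[ℝ] E2 := LinearMap.toContinuousLinearMap
  { toFun := fun x => !₂[x 0, x 1]
    map_add' := fun x y => by ext i; fin_cases i <;> simp
    map_smul' := fun c x => by ext i; fin_cases i <;> simp }

theorem pr_apply (x : E3) : pr x = !₂[x 0, x 1] := rfl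

theorem pr_pt (y : E2) (s : ℝ) : pr (pt y s) = y := by
  ext i; fin_cases i <;> simp [pr_apply, pt]

theorem pt_two (y : E2) (s : ℝ) : pt y s 2 = s := by simp [pt]

theorem pt_pr (x : E3) : pt (pr x) (x 2) = x := by
  ext i; fin_cases i <;> simp [pr_apply, pt]

/-- The standard basis vectors of `ℝ²`. -/
abbrev e2 (i : Fin 2) : E2 := EuclideanSpace.single i 1

theorem pr_eq_sum (x : E3) : pr x = x 0 • e2 0 + x 1 • e2 1 := by
  ext i; fin_cases i <;> simp [pr_apply]

/-- The norm of the point `(y, s)` of `ℝ³`. -/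
def rad (y : E2) (s : ℝ) : ℝ := √(‖y‖ ^ 2 + s ^ 2)

theorem norm_pt (y : E2) (s : ℝ) : ‖pt y s‖ = rad y s := by
  rw [rad, EuclideanSpace.norm_eq, EuclideanSpace.norm_sq_eq]
  simp [Fin.sum_univ_three, pt]

theorem norm_eq_rad (x : E3) : ‖x‖ = rad (pr x) (x 2) := by rw [← norm_pt, pt_pr]

theorem rad_nonneg (y : E2) (s : ℝ) : 0 ≤ rad y s := Real.sqrt_nonneg _

theorem norm_le_rad (y : E2) (s : ℝ) : ‖y‖ ≤ rad y s :=
  Real.le_sqrt_of_sq_le (by nlinarith [sq_nonneg s])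

theorem abs_le_rad (y : E2) (s : ℝ) : |s| ≤ rad y s :=
  Real.le_sqrt_of_sq_le (by rw [sq_abs]; nlinarith [sq_nonneg ‖y‖])

theorem rad_le (y : E2) (s : ℝ) : rad y s ≤ ‖y‖ + |s| := by
  refine (Real.sqrt_le_left (by positivity)).2 ?_
  nlinarith [sq_abs s, mul_nonneg (norm_nonneg y) (abs_nonneg s)]

theorem rad_pos {y : E2} (hy : y ≠ 0) (s : ℝ) : 0 < rad y s :=
  (norm_pos_iff.2 hy).trans_le (norm_le_rad y s)

/-- The differential `dxᵢ` with complex coefficients. -/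
def dxL (i : Fin 3) : ℂ →L[ℝ] E3 →L[ℝ] ℂ :=
  ContinuousLinearMap.smulRightL ℝ E3 ℂ (EuclideanSpace.proj i)

theorem dxL_apply (i : Fin 3) (c : ℂ) (v : E3) : dxL i c v = v i * c := by
  simp [dxL]

/-- The integrand of the spherical back-projection, with the weight `|x - ξ|⁻ˡ`, at the point
`ξ = x₁₂ + y` of the observation plane. -/
def bpKernel (l : ℕ) (φ : SchwartzTime) (x : E3) (y : E2) : ℂ :=
  φ.1 (rad y (x 2), pr x + y) * (((rad y (x 2))⁻¹ ^ l : ℝ) : ℂ)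

/-- Flatness of `φ` at `t = 0` pays for the singular weight, and its decay controls `x` because `‖x‖
≤ 2 rad + ‖ξ‖` with `ξ = pr x + y`. The cubed factor is kept for integrability over the plane, where
the exponent must exceed `2`. -/
theorem bpKernel_bound (k l : ℕ) :
    ∃ p : Seminorm ℂ SchwartzTime, Continuous p ∧ ∀ φ x y,
      (1 + ‖x‖) ^ k * (1 + rad y (x 2) + ‖pr x + y‖) ^ 3 * ‖bpKernel l φ x y‖ ≤ p φ := by
  obtain ⟨p, hp, hb⟩ := SchwartzTime.exists_bound (k + 3) l
  refine ⟨((2 : NNReal) ^ k) • p, hp.const_smul _, fun φ x y => ?_⟩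
  simp only [smul_apply, NNReal.smul_def, smul_eq_mul, NNReal.coe_pow, NNReal.coe_ofNat, bpKernel]
  set ρ := rad y (x 2) with hρ
  have hρ0 : 0 ≤ ρ := rad_nonneg _ _
  rcases hρ0.eq_or_lt with h0 | h0
  · rw [← h0, SchwartzTime.eq_zero φ le_rfl]
    simp
  · have h2 : 1 + ‖x‖ ≤ 2 * (1 + ρ + ‖pr x + y‖) := by
      have a1 := (norm_eq_rad x).le.trans (rad_le _ _)
      have a2 : ‖pr x‖ ≤ ‖pr x + y‖ + ‖y‖ := by
        calc ‖pr x‖ = ‖(pr x + y) - y‖ := by rw [add_sub_cancel_right]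
          _ ≤ _ := norm_sub_le _ _
      linarith [norm_le_rad y (x 2), abs_le_rad y (x 2), norm_nonneg (pr x + y)]
    rw [norm_mul, Complex.norm_real, Real.norm_eq_abs, abs_of_nonneg (by positivity)]
    calc _ ≤ (2 * (1 + ρ + ‖pr x + y‖)) ^ k * (1 + ρ + ‖pr x + y‖) ^ 3 *
          (‖φ.1 (ρ, pr x + y)‖ * ρ⁻¹ ^ l) := by gcongr
      _ = 2 ^ k * ((1 + ρ + ‖pr x + y‖) ^ (k + 3) * ‖φ.1 (ρ, pr x + y)‖) * ρ⁻¹ ^ l := by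
          rw [mul_pow, pow_add]; ring
      _ ≤ 2 ^ k * (p φ * ρ ^ l) * ρ⁻¹ ^ l := by
          gcongr ?_ * _
          exact mul_le_mul_of_nonneg_left (hb φ ρ _ hρ0) (by positivity)
      _ = 2 ^ k * p φ := by
          rw [inv_pow]; field_simp

theorem integrable_weight : Integrable fun y : E2 => ((1 + ‖y‖) ^ 3)⁻¹ := by
  have := integrable_one_add_norm (E := E2) (μ := volume) (r := 3) (by simp; norm_num)
  refine this.congr (Eventually.of_forall fun y => ?_)
  change (1 + ‖y‖) ^ (-(3 : ℝ)) = _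
  rw [Real.rpow_neg (by positivity)]
  norm_cast

theorem bpKernel_bound' (k l : ℕ) :
    ∃ p : Seminorm ℂ SchwartzTime, Continuous p ∧ ∀ φ x y,
      (1 + ‖x‖) ^ k * ‖bpKernel l φ x y‖ ≤ p φ * ((1 + ‖y‖) ^ 3)⁻¹ := by
  obtain ⟨p, hp, hb⟩ := bpKernel_bound k l
  refine ⟨p, hp, fun φ x y => ?_⟩
  rw [← div_eq_mul_inv, le_div_iff₀ (by positivity)]
  have h1 : 1 + ‖y‖ ≤ 1 + rad y (x 2) + ‖pr x + y‖ := by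
    linarith [norm_le_rad y (x 2), norm_nonneg (pr x + y)]
  calc _ = (1 + ‖x‖) ^ k * (1 + ‖y‖) ^ 3 * ‖bpKernel l φ x y‖ := by ring
    _ ≤ (1 + ‖x‖) ^ k * (1 + rad y (x 2) + ‖pr x + y‖) ^ 3 * ‖bpKernel l φ x y‖ := by gcongr
    _ ≤ _ := hb φ x y

theorem measurable_bpKernel (l : ℕ) (φ : SchwartzTime) :
    Measurable fun z : E3 × E2 => bpKernel l φ z.1 z.2 := by
  have hr : Continuous fun z : E3 × E2 => rad z.2 (z.1 2) := by unfold rad; fun_prop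
  have hφ : Continuous fun z : E3 × E2 => φ.1 (rad z.2 (z.1 2), pr z.1 + z.2) :=
    φ.1.continuous.comp (by fun_prop)
  exact hφ.measurable.mul (Complex.measurable_ofReal.comp (hr.measurable.inv.pow_const l))

theorem integrable_bpKernel (l : ℕ) (φ : SchwartzTime) (x : E3) : Integrable (bpKernel l φ x) := by
  obtain ⟨p, -, hb⟩ := bpKernel_bound' 0 l
  refine (integrable_weight.const_mul (p φ)).mono'
    ((measurable_bpKernel l φ).comp (measurable_prodMk_left)).aestronglyMeasurable
    (Eventually.of_forall fun y => ?_)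
  simpa using hb φ x y

/-- The derivative of `bpKernel l φ x y` with respect to `x`. -/
def bpKernelDeriv (l : ℕ) (φ : SchwartzTime) (x : E3) (y : E2) : E3 →L[ℝ] ℂ :=
  dxL 0 (bpKernel l (SchwartzTime.deriv (0, e2 0) φ) x y)
    + dxL 1 (bpKernel l (SchwartzTime.deriv (0, e2 1) φ) x y)
    + x 2 • dxL 2 (bpKernel (l + 1) (SchwartzTime.deriv (1, 0) φ) x y)
    - (l * x 2) • dxL 2 (bpKernel (l + 2) φ x y)

theorem hasFDerivAt_rad {y : E2} (hy : y ≠ 0) (x : E3) :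
    HasFDerivAt (fun x : E3 => rad y (x 2))
      ((x 2 / rad y (x 2)) • (EuclideanSpace.proj 2 : E3 →L[ℝ] ℝ)) x := by
  have hr := rad_pos hy (x 2)
  have h1 : HasDerivAt (fun s : ℝ => rad y s) (x 2 / rad y (x 2)) (x 2) := by
    have h2 : HasDerivAt (fun s : ℝ => ‖y‖ ^ 2 + s ^ 2) (2 * x 2) (x 2) := by
      simpa using ((hasDerivAt_id (x 2)).pow 2).const_add (‖y‖ ^ 2)
    have hne : ‖y‖ ^ 2 + x 2 ^ 2 ≠ 0 := (Real.sqrt_pos.1 hr).ne'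
    refine (h2.sqrt hne).congr_deriv ?_
    rw [rad]; field_simp
  exact HasDerivAt.comp_hasFDerivAt (h₂ := fun s => rad y s) (f := fun x : E3 => x 2) x h1
    (EuclideanSpace.proj 2 : E3 →L[ℝ] ℝ).hasFDerivAt

theorem hasFDerivAt_bpKernel (l : ℕ) (φ : SchwartzTime) {y : E2} (hy : y ≠ 0) (x : E3) :
    HasFDerivAt (fun x => bpKernel l φ x y) (bpKernelDeriv l φ x y) x := by
  have hr := rad_pos hy (x 2)
  have hrad := hasFDerivAt_rad hy x
  have h1 : HasFDerivAt (fun x => φ.1 (rad y (x 2), pr x + y)) _ x :=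
    (φ.1.hasFDerivAt (rad y (x 2), pr x + y)).comp x (hrad.prodMk (pr.hasFDerivAt.add_const y))
  have h2 : HasDerivAt (fun r : ℝ => r⁻¹ ^ l) (-(l * (rad y (x 2))⁻¹ ^ (l + 1)))
      (rad y (x 2)) := by
    refine (((hasDerivAt_inv hr.ne').pow l)).congr_deriv ?_
    rcases l with _ | l
    · simp
    · simp only [Nat.add_sub_cancel, inv_pow]; field_simp; ring
  have h3 := h1.mul (Complex.ofRealCLM.hasFDerivAt.comp x
    (HasDerivAt.comp_hasFDerivAt (h₂ := fun r : ℝ => r⁻¹ ^ l)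
      (f := fun x : E3 => rad y (x 2)) x h2 hrad))
  refine h3.congr_fderiv ?_
  ext v
  have hv : (((x 2 / rad y (x 2)) * v 2, pr v) : ℝ × E2) =
      ((x 2 / rad y (x 2)) * v 2) • (1, 0) + v 0 • (0, e2 0) + v 1 • (0, e2 1) := by
    rw [pr_eq_sum]; ext <;> simp
  have hrc : ((rad y (x 2) : ℝ) : ℂ) ≠ 0 := by exact_mod_cast hr.ne'
  have hproj : (EuclideanSpace.proj 2 : E3 →L[ℝ] ℝ) v = v 2 := rfl
  simp only [bpKernelDeriv, bpKernel, SchwartzTime.deriv_apply, add_apply, sub_apply, smul_apply,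
    dxL_apply, ContinuousLinearMap.comp_apply, ContinuousLinearMap.prod_apply,
    hproj, Function.comp_apply, Complex.ofRealCLM_apply, smul_eq_mul, hv, map_add, map_smul,
    Complex.real_smul]
  push_cast
  simp only [inv_pow]
  field_simp
  ring

/-- The back-projection with weight `|x - ξ|⁻ˡ`. -/
def backProj (l : ℕ) (φ : SchwartzTime) (x : E3) : ℂ := ∫ y, bpKernel l φ x y

theorem hasFDerivAt_backProj (l : ℕ) (φ : SchwartzTime) (x : E3) :
    HasFDerivAt (backProj l φ)
      (dxL 0 (backProj l (SchwartzTime.deriv (0, e2 0) φ) x)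
        + dxL 1 (backProj l (SchwartzTime.deriv (0, e2 1) φ) x)
        + x 2 • dxL 2 (backProj (l + 1) (SchwartzTime.deriv (1, 0) φ) x)
        - (l * x 2) • dxL 2 (backProj (l + 2) φ x)) x := by
  obtain ⟨p0, -, hb0⟩ := bpKernel_bound' 0 l
  obtain ⟨p1, -, hb1⟩ := bpKernel_bound' 1 (l + 1)
  obtain ⟨p2, -, hb2⟩ := bpKernel_bound' 1 (l + 2)
  simp only [pow_zero, pow_one, one_mul] at hb0 hb1 hb2
  have hx2 : ∀ x : E3, |x 2| ≤ 1 + ‖x‖ := fun x => by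
    linarith [(abs_le_rad (pr x) (x 2)).trans (norm_eq_rad x).ge]
  have i0 := (dxL 0).integrable_comp (integrable_bpKernel l (SchwartzTime.deriv (0, e2 0) φ) x)
  have i1 := (dxL 1).integrable_comp (integrable_bpKernel l (SchwartzTime.deriv (0, e2 1) φ) x)
  have i2 := ((dxL 2).integrable_comp
    (integrable_bpKernel (l + 1) (SchwartzTime.deriv (1, 0) φ) x)).smul (x 2)
  have i3 := ((dxL 2).integrable_comp (integrable_bpKernel (l + 2) φ x)).smul (l * x 2)
  have key := hasFDerivAt_integral_of_dominated_of_fderiv_le (𝕜 := ℝ) (μ := (volume : Measure E2))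
    (F := fun x y => bpKernel l φ x y) (F' := fun x y => bpKernelDeriv l φ x y) (x₀ := x)
    (s := univ) (bound := fun y => (‖dxL 0‖ * p0 (SchwartzTime.deriv (0, e2 0) φ)
      + ‖dxL 1‖ * p0 (SchwartzTime.deriv (0, e2 1) φ)
      + ‖dxL 2‖ * p1 (SchwartzTime.deriv (1, 0) φ) + l * (‖dxL 2‖ * p2 φ)) * ((1 + ‖y‖) ^ 3)⁻¹)
    univ_mem (Eventually.of_forall fun x => (integrable_bpKernel l φ x).aestronglyMeasurable)
    (integrable_bpKernel l φ x) (((i0.add i1).add i2).sub i3).aestronglyMeasurable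
    (Eventually.of_forall fun y x _ => ?_) (integrable_weight.const_mul _)
    (by
      -- Off the null point `y = 0` the radius is positive for every `x`, so one exceptional set
      -- serves all base points.
      filter_upwards [compl_mem_ae_iff.2 (measure_singleton (0 : E2))] with y hy x _
      exact hasFDerivAt_bpKernel l φ hy x)
  · refine key.congr_fderiv ?_
    have e := integral_sub ((i0.add i1).add i2) i3
    have e' := integral_add (i0.add i1) i2
    have e'' := integral_add i0 i1
    simp only [Pi.add_apply, Pi.smul_apply] at e e' e''
    simp only [bpKernelDeriv]
    rw [e, e', e'', integral_smul, integral_smul]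
    simp only [ContinuousLinearMap.integral_comp_comm _ (integrable_bpKernel _ _ x), backProj]
  · have b0 := (dxL 0).le_of_opNorm_le_of_le le_rfl (hb0 (SchwartzTime.deriv (0, e2 0) φ) x y)
    have b1 := (dxL 1).le_of_opNorm_le_of_le le_rfl (hb0 (SchwartzTime.deriv (0, e2 1) φ) x y)
    have b2 : ‖x 2 • dxL 2 (bpKernel (l + 1) (SchwartzTime.deriv (1, 0) φ) x y)‖ ≤
        ‖dxL 2‖ * (p1 (SchwartzTime.deriv (1, 0) φ) * ((1 + ‖y‖) ^ 3)⁻¹) := by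
      rw [← map_smul]
      refine (dxL 2).le_of_opNorm_le_of_le le_rfl (le_trans ?_ (hb1 _ x y))
      rw [norm_smul]; gcongr; exact hx2 x
    have b3 : ‖(l * x 2) • dxL 2 (bpKernel (l + 2) φ x y)‖ ≤
        l * (‖dxL 2‖ * (p2 φ * ((1 + ‖y‖) ^ 3)⁻¹)) := by
      rw [mul_smul, norm_smul, Real.norm_natCast, ← map_smul]
      gcongr
      refine (dxL 2).le_of_opNorm_le_of_le le_rfl (le_trans ?_ (hb2 _ x y))
      rw [norm_smul]; gcongr; exact hx2 x
    have n1 := norm_sub_le (dxL 0 (bpKernel l (SchwartzTime.deriv (0, e2 0) φ) x y)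
      + dxL 1 (bpKernel l (SchwartzTime.deriv (0, e2 1) φ) x y)
      + x 2 • dxL 2 (bpKernel (l + 1) (SchwartzTime.deriv (1, 0) φ) x y))
      ((l * x 2) • dxL 2 (bpKernel (l + 2) φ x y))
    have n2 := norm_add₃_le (a := dxL 0 (bpKernel l (SchwartzTime.deriv (0, e2 0) φ) x y))
      (b := dxL 1 (bpKernel l (SchwartzTime.deriv (0, e2 1) φ) x y))
      (c := x 2 • dxL 2 (bpKernel (l + 1) (SchwartzTime.deriv (1, 0) φ) x y))
    refine n1.trans ?_
    linarith

theorem exists_backProj_schwartz :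
    ∃ T : SchwartzTime →L[ℂ] 𝓢(E3, ℂ), ∀ φ x, T φ x = backProj 1 φ x := by
  -- Differentiating in `x₃` produces a factor `x₃` and higher negative powers of the radius; this
  -- two-parameter family is closed under differentiation.
  let f : ℕ × ℕ → SchwartzTime → E3 → ℂ := fun i φ x => ((x 2 : ℝ) : ℂ) ^ i.1 * backProj i.2 φ x
  suffices h : ∃ T : SchwartzTime →L[ℂ] 𝓢(E3, ℂ), ∀ φ x, T φ x = f (0, 1) φ x by
    simpa [f] using h
  refine exists_schwartz_of_family (f := f) ?_ ?_ ?_ ?_ (0, 1)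
  · intro i φ ψ x
    simp only [f, backProj, ← mul_add]
    rw [← integral_add (integrable_bpKernel _ _ _) (integrable_bpKernel _ _ _)]
    simp only [bpKernel, Submodule.coe_add, add_apply, add_mul]
  · intro i c φ x
    simp only [f, backProj]
    rw [mul_left_comm, ← integral_const_mul c]
    simp only [bpKernel, Submodule.coe_smul, smul_apply, smul_eq_mul, mul_assoc]
  · rintro ⟨m, l⟩ k
    obtain ⟨p, hp, hb⟩ := bpKernel_bound' (k + m) l
    let C : NNReal := ⟨∫ y : E2, ((1 + ‖y‖) ^ 3)⁻¹, integral_nonneg fun y => by positivity⟩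
    refine ⟨C • p, hp.const_smul C, fun φ x => ?_⟩
    have hx2 : |x 2| ≤ 1 + ‖x‖ := by
      linarith [(abs_le_rad (pr x) (x 2)).trans (norm_eq_rad x).ge]
    simp only [f, norm_mul, norm_pow, Complex.norm_real, Real.norm_eq_abs]
    calc ‖x‖ ^ k * (|x 2| ^ m * ‖backProj l φ x‖) ≤
          (1 + ‖x‖) ^ k * ((1 + ‖x‖) ^ m * ∫ y, ‖bpKernel l φ x y‖) := by
          gcongr
          · linarith
          · exact norm_integral_le_integral_norm _
      _ = ∫ y, (1 + ‖x‖) ^ (k + m) * ‖bpKernel l φ x y‖ := by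
          rw [integral_const_mul, pow_add]; ring
      _ ≤ ∫ y : E2, p φ * ((1 + ‖y‖) ^ 3)⁻¹ :=
          integral_mono ((integrable_bpKernel l φ x).norm.const_mul _)
            (integrable_weight.const_mul _) fun y => hb φ x y
      _ = _ := by
          rw [integral_const_mul, mul_comm]; rfl
  · rintro ⟨m, l⟩
    -- The truncated index `m - 1` is harmless for `m = 0`, since that term has coefficient `m`.
    refine ⟨5, ![(m, l), (m, l), (m + 1, l + 1), (m - 1, l), (m + 1, l + 2)],
      ![SchwartzTime.deriv (0, e2 0), SchwartzTime.deriv (0, e2 1), SchwartzTime.deriv (1, 0),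
        ContinuousLinearMap.id ℂ _, ContinuousLinearMap.id ℂ _],
      ![dxL 0, dxL 1, dxL 2, (m : ℝ) • dxL 2, (-(l : ℝ)) • dxL 2], fun φ x => ?_⟩
    have h1 : HasFDerivAt (fun x : E3 => ((x 2 : ℝ) : ℂ)) (dxL 2 1) x := by
      have := Complex.ofRealCLM.hasFDerivAt.comp x
        (EuclideanSpace.proj 2 : E3 →L[ℝ] ℝ).hasFDerivAt
      refine this.congr_fderiv ?_
      ext v; simp [dxL_apply]
    refine ((h1.pow m).mul (hasFDerivAt_backProj l φ x)).congr_fderiv ?_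
    ext v
    simp [f, Fin.sum_univ_five, dxL_apply]
    ring

/-! ### The time-domain formula and the adjoint identity. -/

/-- The integrand of the adjoint in the time domain. -/
def bp (φ : SchwartzTime) (x : E3) (ξ : E2) : ℂ :=
  φ.1 (‖x - pt ξ 0‖, ξ) * ((‖x - pt ξ 0‖⁻¹ : ℝ) : ℂ)

theorem norm_sub_pt (x : E3) (ξ : E2) : ‖x - pt ξ 0‖ = rad (ξ - pr x) (x 2) := by
  have h : x - pt ξ 0 = pt (pr x - ξ) (x 2) := by
    ext i; fin_cases i <;> simp [pr_apply, pt]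
  rw [h, norm_pt, rad, rad, norm_sub_rev]

theorem bp_eq (φ : SchwartzTime) (x : E3) (ξ : E2) : bp φ x ξ = bpKernel 1 φ x (ξ - pr x) := by
  simp only [bp, bpKernel, norm_sub_pt, pow_one, add_sub_cancel]

theorem integrable_bp (φ : SchwartzTime) (x : E3) : Integrable (bp φ x) := by
  simpa only [funext (bp_eq φ x)] using (integrable_bpKernel 1 φ x).comp_sub_right (pr x)

theorem integral_bp (φ : SchwartzTime) (x : E3) : ∫ ξ, bp φ x ξ = backProj 1 φ x := by
  simp only [bp_eq, backProj]
  exact integral_sub_right_eq_self (bpKernel 1 φ x) (pr x)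

theorem continuous_pt_zero : Continuous fun ξ : E2 => pt ξ 0 := by
  unfold pt
  refine (PiLp.continuous_toLp 2 _).comp (continuous_pi fun i => ?_)
  fin_cases i <;> simp <;> fun_prop

theorem integrable_bp_prod (φ : SchwartzTime) :
    Integrable (fun z : E3 × E2 => bp φ z.1 z.2) := by
  obtain ⟨p, -, hb⟩ := bpKernel_bound 4 1
  have hw : Integrable fun x : E3 => ((1 + ‖x‖) ^ 4)⁻¹ := by
    have := integrable_one_add_norm (E := E3) (μ := volume) (r := 4) (by simp; norm_num)
    refine this.congr (Eventually.of_forall fun y => ?_)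
    change (1 + ‖y‖) ^ (-(4 : ℝ)) = _
    rw [Real.rpow_neg (by positivity)]
    norm_cast
  have hm : Measurable fun z : E3 × E2 => bp φ z.1 z.2 := by
    simp only [bp_eq]
    exact (measurable_bpKernel 1 φ).comp (f := fun z : E3 × E2 => (z.1, z.2 - pr z.1)) (by fun_prop)
  -- The exponents `4 > 3` in `x` and `3 > 2` in `ξ` make the product weight integrable.
  refine Integrable.mono' ((hw.mul_prod integrable_weight).const_mul (p φ))
    hm.aestronglyMeasurable (Eventually.of_forall fun z => ?_)
  rw [bp_eq, ← mul_inv, ← div_eq_mul_inv, le_div_iff₀ (by positivity)]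
  have h1 := hb φ z.1 (z.2 - pr z.1)
  rw [add_sub_cancel] at h1
  refine le_trans ?_ h1
  rw [mul_comm]
  gcongr
  linarith [rad_nonneg (z.2 - pr z.1) (z.1 2)]

theorem exists_adjoint :
    ∃ T : SchwartzTime →L[ℂ] SchwartzEven, ∀ φ x,
      (T φ).1 x = 1 / (4 * (Real.pi : ℂ)) * ∫ ξ : E2, bp φ x ξ := by
  obtain ⟨T, hT⟩ := exists_backProj_schwartz
  refine ⟨((1 / (4 * (Real.pi : ℂ))) • T).codRestrict SchwartzEven fun φ y s => ?_, fun φ x => ?_⟩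
  · change (1 / (4 * (Real.pi : ℂ))) * T φ _ = (1 / (4 * (Real.pi : ℂ))) * T φ _
    simp only [hT, backProj, bpKernel, pr_pt, pt_two, rad, neg_sq]
  · change (1 / (4 * (Real.pi : ℂ))) * T φ _ = _
    rw [hT, integral_bp]

/-- Polar coordinates centred at the detector `(ξ, 0)` are taken in `y = x - (ξ, 0)`; this matches
the radial weight there with the back-projection integrand at `x`. -/
theorem newton_mul (φ : SchwartzTime) (ξ : E2) (y : E3) :
    newton y * φ.1 (‖y‖, ξ) = (4 * (Real.pi : ℂ))⁻¹ * bp φ (pt ξ 0 + y) ξ := by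
  simp only [newton, bp, add_sub_cancel_left]
  push_cast
  ring

theorem star_newton (y : E3) : starRingEnd ℂ (newton y) = newton y := Complex.conj_ofReal _

theorem newton_mul_star (φ : SchwartzTime) (ξ : E2) (y : E3) :
    newton y * starRingEnd ℂ (φ.1 (‖y‖, ξ)) =
      (4 * (Real.pi : ℂ))⁻¹ * starRingEnd ℂ (bp φ (pt ξ 0 + y) ξ) := by
  have h := congrArg (starRingEnd ℂ) (newton_mul φ ξ y)
  simpa [star_newton, map_ofNat (starRingEnd ℂ) 4] using h

instance : (volume : Measure (ℝ × E2)).IsAddHaarMeasure :=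
  inferInstanceAs ((volume : Measure ℝ).prod (volume : Measure E2)).IsAddHaarMeasure

section adjoint

variable (h : 𝓢(E3, ℂ)) (φ : SchwartzTime)

theorem R_mul_star_eq (z : ℝ × E2) :
    R h z.1 z.2 * starRingEnd ℂ (φ.1 z) =
      sphMean h z.1 (pt z.2 0) * starRingEnd ℂ (φ.1 z) := by
  by_cases hz : 0 ≤ z.1
  · rw [R_of_nonneg (h.smooth ⊤) hz]
  · have : φ.1 z = 0 := SchwartzTime.eq_zero φ (not_le.1 hz).le z.2
    simp [this]

theorem norm_sphMean_le {f : E3 → ℂ} {C : ℝ} (hC : ∀ x, ‖f x‖ ≤ C) (t : ℝ) (x : E3) :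
    ‖sphMean f t x‖ ≤ C * |t| := by
  have h1 : ‖∫ η : S2, t * f (x + t • (η : E3)) ∂surf‖ ≤ (|t| * C) * surf.real univ := by
    refine norm_integral_le_of_norm_le_const (Eventually.of_forall fun η => ?_)
    rw [norm_mul, Complex.norm_real, Real.norm_eq_abs]
    gcongr
    exact hC _
  rw [surf_univ] at h1
  rw [sphMean, norm_mul, norm_inv]
  have h2 : ‖(4 * Real.pi : ℂ)‖ = 4 * Real.pi := by
    rw [norm_mul, Complex.norm_real, Real.norm_of_nonneg Real.pi_pos.le]; simp
  rw [h2, inv_mul_le_iff₀ (by positivity)]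
  linarith

theorem integrable_R_mul_star :
    Integrable fun z : ℝ × E2 => R h z.1 z.2 * starRingEnd ℂ (φ.1 z) := by
  simp only [R_mul_star_eq]
  have hc := (continuous_sphMean h.continuous).comp
    (f := fun z : ℝ × E2 => ((z.1, pt z.2 0) : ST))
    (continuous_fst.prodMk (continuous_pt_zero.comp continuous_snd))
  have hφ := φ.1.continuous
  refine Integrable.mono' ((φ.1.integrable_pow_mul volume 1).const_mul
    (SchwartzMap.seminorm ℂ 0 0 h))
    (hc.mul (Complex.continuous_conj.comp hφ)).aestronglyMeasurable
    (Eventually.of_forall fun z => ?_)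
  rw [norm_mul, RCLike.norm_conj, pow_one, ← mul_assoc]
  gcongr
  refine (norm_sphMean_le (fun x => SchwartzMap.norm_le_seminorm ℂ h x) _ _).trans ?_
  gcongr
  exact norm_fst_le z

theorem integrable_mul_star_bp :
    Integrable fun z : E3 × E2 => h z.1 * ((4 * (Real.pi : ℂ))⁻¹ * starRingEnd ℂ (bp φ z.1 z.2)) := by
  have h1 : Integrable fun z : E3 × E2 => starRingEnd ℂ (bp φ z.1 z.2) :=
    (integrable_bp_prod φ).congr' (by
      exact Complex.continuous_conj.comp_aestronglyMeasurable
        (integrable_bp_prod φ).aestronglyMeasurable) (by simp)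
  exact (h1.const_mul _).bdd_mul (c := SchwartzMap.seminorm ℂ 0 0 h)
    (h.continuous.comp continuous_fst).aestronglyMeasurable
    (Eventually.of_forall fun z => SchwartzMap.norm_le_seminorm ℂ h z.1)

theorem integral_R_mul_star :
    ∫ z : ℝ × E2, R h z.1 z.2 * starRingEnd ℂ (φ.1 z) =
      ∫ x : E3, h x * starRingEnd ℂ (1 / (4 * (Real.pi : ℂ)) * ∫ ξ : E2, bp φ x ξ) := by
  have hint := integrable_R_mul_star h φ
  have hG := integrable_mul_star_bp h φ
  simp only [R_mul_star_eq] at hint ⊢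
  rw [Measure.volume_eq_prod] at hint ⊢
  rw [integral_prod_symm _ hint]
  have hae : ∀ᵐ ξ : E2, ∫ t, sphMean h t (pt ξ 0) * starRingEnd ℂ (φ.1 (t, ξ)) =
      ∫ x, h x * ((4 * (Real.pi : ℂ))⁻¹ * starRingEnd ℂ (bp φ x ξ)) := by
    -- For almost every detector `ξ` the slice is integrable in `x`; translating to the detector and
    -- passing to polar coordinates identifies it with the time integral of the spherical mean.
    have hG' := hG
    rw [Measure.volume_eq_prod] at hG'
    filter_upwards [hG'.prod_left_ae] with ξ hξ
    have e : ∀ y, newton y * (h (pt ξ 0 + y) * starRingEnd ℂ (φ.1 (‖y‖, ξ))) =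
        h (pt ξ 0 + y) * ((4 * (Real.pi : ℂ))⁻¹ * starRingEnd ℂ (bp φ (pt ξ 0 + y) ξ)) :=
      fun y => by rw [← newton_mul_star]; ring
    have hi := hξ.comp_add_left (pt ξ 0)
    simp only [← e] at hi
    rw [← integral_add_left_eq_self _ (pt ξ 0)]
    simp only [← e]
    rw [← integral_Ioi_sphMean_mul (f := fun t => starRingEnd ℂ (φ.1 (t, ξ))) hi,
      ← setIntegral_eq_integral_of_forall_compl_eq_zero (s := Ioi 0)]
    intro t ht
    rw [SchwartzTime.eq_zero φ (not_lt.1 ht)]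
    simp
  rw [integral_congr_ae hae, integral_integral_swap (f := fun ξ x =>
    h x * ((4 * (Real.pi : ℂ))⁻¹ * starRingEnd ℂ (bp φ x ξ))) hG.swap]
  congr 1
  funext x
  rw [integral_const_mul, integral_const_mul, integral_conj]
  simp [map_ofNat (starRingEnd ℂ) 4]

end adjoint

/-! ### The frequency-domain formula. -/

section frequency

variable (φ : SchwartzTime)

theorem inner_pt_pt (σ ξ : E2) (ρ : ℝ) : ⟪pt σ ρ, pt ξ 0⟫_ℝ = ⟪σ, ξ⟫_ℝ := by
  simp [PiLp.inner_apply, Fin.sum_univ_three, pt]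

theorem mul_integral_sphere_exp {k : E3} (hk : k ≠ 0) (r : ℝ) :
    r * ∫ η : S2, Complex.exp (Complex.I * ((⟪k, r • (η : E3)⟫_ℝ : ℝ) : ℂ)) ∂surf =
      4 * Real.pi * (Real.sin (r * ‖k‖) / ‖k‖) := by
  have hk0 : (‖k‖ : ℂ) ≠ 0 := by exact_mod_cast norm_ne_zero_iff.2 hk
  have hu : ‖‖k‖⁻¹ • k‖ = 1 := by simp [norm_smul, hk]
  have h1 := integral_sphere_exp hu (r * ‖k‖)
  have e : ∀ η : S2, (r * ‖k‖) * ⟪‖k‖⁻¹ • k, (η : E3)⟫_ℝ = ⟪k, r • (η : E3)⟫_ℝ := fun η => by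
    rw [real_inner_smul_left, real_inner_smul_right]
    have := norm_ne_zero_iff.2 hk
    field_simp
  simp only [e] at h1
  push_cast at h1 ⊢
  rw [← mul_div_assoc, eq_div_iff hk0, ← h1]
  ring

/-- Euler's formula: the difference of the transforms at `w` and `-w` is a sine transform in time,
the form in which the sphere integral of a plane wave appears. -/
theorem fourierTime_sub (w : ℝ) (σ : E2) :
    1 / (2 * Complex.I) * ((fourierTime φ.1 w σ - fourierTime φ.1 (-w) σ) / (w : ℂ)) =
      (((2 * Real.pi) ^ (3 / 2 : ℝ) : ℝ) : ℂ)⁻¹ * ∫ z : ℝ × E2,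
        φ.1 z * (Real.sin (z.1 * w) / w : ℂ) * Complex.exp (Complex.I * ((⟪σ, z.2⟫_ℝ : ℝ) : ℂ)) := by
  have hi : ∀ w : ℝ, Integrable fun z : ℝ × E2 =>
      φ.1 z * Complex.exp (Complex.I * ((w * z.1 + ⟪σ, z.2⟫_ℝ : ℝ) : ℂ)) := fun w => by
    refine φ.1.integrable.mul_bdd (c := 1) (by fun_prop) (Eventually.of_forall fun z => ?_)
    rw [mul_comm, Complex.norm_exp_ofReal_mul_I]
  have key : ∫ z : ℝ × E2, φ.1 z * (Real.sin (z.1 * w) / w : ℂ) *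
      Complex.exp (Complex.I * ((⟪σ, z.2⟫_ℝ : ℝ) : ℂ)) = 1 / (2 * Complex.I) / w *
      ((∫ z : ℝ × E2, φ.1 z * Complex.exp (Complex.I * ((w * z.1 + ⟪σ, z.2⟫_ℝ : ℝ) : ℂ)))
      - ∫ z : ℝ × E2, φ.1 z * Complex.exp (Complex.I * ((-w * z.1 + ⟪σ, z.2⟫_ℝ : ℝ) : ℂ))) := by
    rw [← integral_sub (hi w) (hi (-w)), ← integral_const_mul]
    congr 1
    funext z
    push_cast
    rw [Complex.sin]
    have e1 : Complex.exp (Complex.I * (w * z.1 + ((⟪σ, z.2⟫_ℝ : ℝ) : ℂ))) =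
        Complex.exp (z.1 * w * Complex.I) * Complex.exp (Complex.I * ((⟪σ, z.2⟫_ℝ : ℝ) : ℂ)) := by
      rw [← Complex.exp_add]; ring_nf
    have e2 : Complex.exp (Complex.I * (-w * z.1 + ((⟪σ, z.2⟫_ℝ : ℝ) : ℂ))) =
        Complex.exp (-(z.1 * w) * Complex.I) * Complex.exp (Complex.I * ((⟪σ, z.2⟫_ℝ : ℝ) : ℂ)) := by
      rw [← Complex.exp_add]; ring_nf
    rw [e1, e2, one_div, mul_inv, Complex.inv_I]
    ring
  rw [key, fourierTime, fourierTime]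
  ring

/-- After Fubini and the shift to the detector, the plane wave splits into its value at `(ξ, 0)` and
a factor whose integral over the sphere of radius `r` supplies `sin(r‖k‖)/‖k‖`. -/
theorem integral_backProj_exp {k : E3} (hk : k ≠ 0) :
    ∫ x : E3, (1 / (4 * (Real.pi : ℂ)) * ∫ ξ : E2, bp φ x ξ) *
        Complex.exp (Complex.I * ((⟪k, x⟫_ℝ : ℝ) : ℂ)) =
      ∫ z : ℝ × E2, φ.1 z * (Real.sin (z.1 * ‖k‖) / ‖k‖ : ℂ) *
        Complex.exp (Complex.I * ((⟪k, pt z.2 0⟫_ℝ : ℝ) : ℂ)) := by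
  have hpt := continuous_pt_zero
  have hG : Integrable fun z : E3 × E2 => ((4 * (Real.pi : ℂ))⁻¹ * bp φ z.1 z.2) *
      Complex.exp (Complex.I * ((⟪k, z.1⟫_ℝ : ℝ) : ℂ)) := by
    refine ((integrable_bp_prod φ).const_mul _).mul_bdd (c := 1) (by fun_prop)
      (Eventually.of_forall fun z => ?_)
    rw [mul_comm, Complex.norm_exp_ofReal_mul_I]
  have hR : Integrable fun z : ℝ × E2 => φ.1 z * (Real.sin (z.1 * ‖k‖) / ‖k‖ : ℂ) *
      Complex.exp (Complex.I * ((⟪k, pt z.2 0⟫_ℝ : ℝ) : ℂ)) := by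
    refine Integrable.mul_bdd (c := 1) ?_ (by fun_prop) (Eventually.of_forall fun z => ?_)
    · refine φ.1.integrable.mul_bdd (c := 1 / ‖k‖) (by fun_prop) (Eventually.of_forall fun z => ?_)
      rw [norm_div, Complex.norm_real, Complex.norm_real, norm_norm, Real.norm_eq_abs]
      gcongr
      exact Real.abs_sin_le_one _
    · rw [mul_comm, Complex.norm_exp_ofReal_mul_I]
  rw [Measure.volume_eq_prod] at hR ⊢
  rw [integral_prod_symm _ hR]
  simp only [one_div, ← integral_const_mul, ← integral_mul_const]
  rw [integral_integral_swap (f := fun x ξ => ((4 * (Real.pi : ℂ))⁻¹ * bp φ x ξ) *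
      Complex.exp (Complex.I * ((⟪k, x⟫_ℝ : ℝ) : ℂ))) hG]
  rw [Measure.volume_eq_prod] at hG
  refine integral_congr_ae ?_
  filter_upwards [hG.prod_left_ae] with ξ hξ
  set c := Complex.exp (Complex.I * ((⟪k, pt ξ 0⟫_ℝ : ℝ) : ℂ)) with hc
  have e : ∀ y, newton y * (φ.1 (‖y‖, ξ) * c * Complex.exp (Complex.I * ((⟪k, y⟫_ℝ : ℝ) : ℂ))) =
      ((4 * (Real.pi : ℂ))⁻¹ * bp φ (pt ξ 0 + y) ξ) *
        Complex.exp (Complex.I * ((⟪k, pt ξ 0 + y⟫_ℝ : ℝ) : ℂ)) := fun y => by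
    rw [← newton_mul, inner_add_right, Complex.ofReal_add, mul_add, Complex.exp_add]; ring
  have hi := hξ.comp_add_left (pt ξ 0)
  simp only [← e] at hi
  rw [← integral_add_left_eq_self _ (pt ξ 0)]
  simp only [← e]
  rw [integral_newton_mul hi, ← setIntegral_eq_integral_of_forall_compl_eq_zero (s := Ioi (0 : ℝ))
    (f := fun t => φ.1 (t, ξ) * (Real.sin (t * ‖k‖) / ‖k‖ : ℂ) * c), ← integral_const_mul]
  · refine setIntegral_congr_fun measurableSet_Ioi fun r hr => ?_
    have hpi : (Real.pi : ℂ) ≠ 0 := by exact_mod_cast Real.pi_ne_zero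
    simp only [norm_smul, norm_coe_S2, mul_one, Real.norm_eq_abs, abs_of_pos (mem_Ioi.1 hr)]
    have := mul_integral_sphere_exp hk r
    rw [integral_const_mul, integral_const_mul, mul_left_comm (r : ℂ), this]
    field_simp
  · intro t ht
    rw [SchwartzTime.eq_zero φ (not_lt.1 ht)]
    simp

end frequency

end Photoacoustic

end

open Photoacoustic
theorem mainTheorem8 :
    -- the operator `R` is well defined, and it is the spherical mean operator
    (∀ h : 𝓢(E3, ℂ), ∃! p : ℝ → E3 → ℂ,
        IsPressure h p) ∧
    (∀ (h : 𝓢(E3, ℂ)) (t : ℝ) (ξ : E2), 0 ≤ t →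
        R h t ξ = (t : ℂ) / (4 * (Real.pi : ℂ)) *
          ∫ η : Metric.sphere (0 : E3) 1,
            h (pt ξ 0 + t • (η : E3))
              ∂((volume : Measure E3).toSphere)) ∧
    -- its adjoint
    ∃ Rstar : SchwartzTime →L[ℂ] SchwartzEven,
      (∀ (h : SchwartzHalfSpace) (φ : SchwartzTime),
        Integrable (fun z : ℝ × E2 =>
          R h.1 z.1 z.2 * starRingEnd ℂ (φ.1 z)) ∧
        ∫ z : ℝ × E2, R h.1 z.1 z.2 * starRingEnd ℂ (φ.1 z) =
          ∫ x : E3, h.1 x * starRingEnd ℂ ((Rstar φ).1 x)) ∧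
      -- in the time domain
      (∀ (φ : SchwartzTime) (x : E3),
        Integrable (fun ξ : E2 =>
          φ.1 (‖x - pt ξ 0‖, ξ) * ((‖x - pt ξ 0‖⁻¹ : ℝ) : ℂ)) ∧
        (Rstar φ).1 x = 1 / (4 * (Real.pi : ℂ)) *
          ∫ ξ : E2,
            φ.1 (‖x - pt ξ 0‖, ξ) * ((‖x - pt ξ 0‖⁻¹ : ℝ) : ℂ)) ∧
      -- in the frequency domain
      (∀ (φ : SchwartzTime) (σ : E2) (ρ : ℝ), (σ, ρ) ≠ (0, 0) →
        fourierSpace (Rstar φ).1 (pt σ ρ) =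
          1 / (2 * Complex.I) *
            ((fourierTime φ.1 (√(‖σ‖ ^ 2 + ρ ^ 2)) σ -
                fourierTime φ.1 (-√(‖σ‖ ^ 2 + ρ ^ 2)) σ) /
              ((√(‖σ‖ ^ 2 + ρ ^ 2) : ℝ) : ℂ))) := by
  refine ⟨fun h => ⟨causalPressure h, isPressure_causalPressure (h.smooth ⊤), fun p hp =>
    hp.unique (isPressure_causalPressure (h.smooth ⊤))⟩, fun h t ξ ht => ?_, ?_⟩
  · rw [R_of_nonneg (h.smooth ⊤) ht, sphMean, integral_const_mul]
    ring
  obtain ⟨T, hT⟩ := exists_adjoint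
  refine ⟨T, fun h φ => ⟨integrable_R_mul_star h.1 φ, ?_⟩, fun φ x => ⟨integrable_bp φ x, hT φ x⟩,
    fun φ σ ρ hne => ?_⟩
  · simp only [hT]
    exact integral_R_mul_star h.1 φ
  · have hnorm : √(‖σ‖ ^ 2 + ρ ^ 2) = ‖pt σ ρ‖ := (norm_pt σ ρ).symm
    have hk : pt σ ρ ≠ 0 := fun h0 => hne (
      Prod.ext (by rw [← pr_pt σ ρ, h0, map_zero]) (by rw [← pt_two σ ρ, h0]; rfl))
    rw [hnorm, fourierTime_sub, fourierSpace]
    simp only [hT]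
    rw [integral_backProj_exp φ hk]
    simp only [inner_pt_pt]
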